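/- Let $G$ be a graph on $n\ge 2$ vertices, let $\lambda_2$ be the second largest eigenvalue (counted with multiplicity) of its adjacency matrix, let $m_G(\lambda_2)$ be the multiplicity of $\lambda_2$ as an eigenvalue of that matrix, and let $\Delta\ge 2$ be a real number such that every vertex of $G$ has degree at most $\Delta$. Here $\log$ denotes the logarithm in base two. (i) If $\Delta\le n^{9}$, then $$m_G(\lambda_2)\le 5n\cdot\max\left\{\frac{\log(\lambda_2+1)}{\lambda_2},\ \frac{\log^2(1+\log_\Delta n)}{\log_\Delta n}\right\},$$ where the first entry of the maximum is read as its limit $\log e$ if $\lambda_2=0$, and as $0$ if $\lambda_2=-1$ (which happens only when $G$ is complete). (ii) If $\lambda_2\ne -1$ (that is, if $G$ is not complete), then for every $0<\varepsilon\le 1$ such that $\log_\Delta n\ge \varepsilon^{-1}(2\lambda_2+2)^{14}\log(\lambda_2+2)$, $$m_G(\lambda_2)\le \frac{n}{\lambda_2+1}+n^{\varepsilon}.$$ -/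

import Mathlib

namespace SecondEigenvalue

variable {V : Type*} [Fintype V] [DecidableEq V]

/-- The `i`-th largest eigenvalue (counted from `0`, with multiplicity) of the adjacency matrix of
`G`: Mathlib's `eigenvalues₀` lists the eigenvalues of a Hermitian matrix in non-increasing
order. -/
noncomputable def eigenvalue (G : SimpleGraph V) [DecidableRel G.Adj]
    (i : Fin (Fintype.card V)) : ℝ :=
  (G.isHermitian_adjMatrix ℝ).eigenvalues₀ i

/-- The second largest eigenvalue `λ₂` of a graph with at least two vertices. -/
noncomputable def lambda2 (G : SimpleGraph V) [DecidableRel G.Adj]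
    (hn : 2 ≤ Fintype.card V) : ℝ :=
  eigenvalue G ⟨1, hn⟩

/-- The multiplicity of `μ` as an eigenvalue of (the adjacency matrix of) `G`: the dimension of
its eigenspace; it is `0` if `μ` is not an eigenvalue. -/
noncomputable def eigMultiplicity (G : SimpleGraph V) [DecidableRel G.Adj] (μ : ℝ) : ℕ :=
  Module.finrank ℝ (Module.End.eigenspace (Matrix.toLin' (G.adjMatrix ℝ)) μ)

/-- The quotient `log₂ (x + 1) / x`, extended to `x = 0` by its limit `log₂ e`.
At `x = -1` its value is `0`. -/
noncomputable def logRatio (x : ℝ) : ℝ :=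
  if x = 0 then Real.logb 2 (Real.exp 1) else Real.logb 2 (x + 1) / x

end SecondEigenvalue

open Matrix Finset

set_option linter.unusedSectionVars false

namespace SecondEigenvalue


/-! ### Eigenbasis expansion and the trace method -/

section Spectral

variable {V : Type*} [Fintype V] [DecidableEq V] {A : Matrix V V ℝ}

/-! Two vectors supported on disjoint sets with no edge between them cannot both have Rayleigh
quotient above λ₂ (`lt_lambda2_of_separated`). So the centres of radius-`k` balls on which the
quadratic form exceeds λ₂ all lie within distance `2k+1` of one another, and there are at most
`Δ^(2k+2)` of them. Stripping them of their edges costs at most that much multiplicity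
(`eigMultiplicity_le_add_isolate`). Afterwards every `k`-ball is locally bounded by λ = λ₂: each
vertex has at most `λ^(2k)` closed walks of length `2k` and degree at most `λ²`.

For a deleted set `Q`, the trace method bounds the multiplicity by `#Q` plus the closed `2k`-walks
avoiding `Q`, divided by `λ^(2k)`. The two bounds differ in the choice of `Q`.

(i) `Q` is random of density `p`. A walk with more than `r` distinct vertices survives with
probability at most `(1-p)^(r+1)`, and walks with at most `r` distinct vertices are few
(`eigMultiplicity_le_of_random_deletion`). Small λ and small `L = log_Δ n` are excluded first: there
the right side is at least `n`.

(ii) `Q` comes from a maximal packing of 2-balls around vertices of degree above `λ - 1/2`. Every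
such vertex is then within distance 4 of `Q`, so the Perron vector of what remains leaks into `Q`,
and the local bound drops to `λ - 1/(20λ⁸)` (`formLE_sub_of_exit`). The surviving walks become
negligible for large `k`. A packed 2-ball has at least `λ + 3/2` vertices unless its centre
dominates its component; such components are treated separately, since λ is at most a simple
eigenvalue there and occurs only if they have at least `λ + 1` vertices. The slack between `1/(λ+1)`
and `1/(λ+3/2)` pays for the walks (`eigMultiplicity_le_div_of_locally_bounded`). -/

theorem eigenvectorBasis_parseval (hA : A.IsHermitian) (x y : V → ℝ) :
    x ⬝ᵥ y = ∑ i, ((hA.eigenvectorBasis i).ofLp ⬝ᵥ x) * ((hA.eigenvectorBasis i).ofLp ⬝ᵥ y) := by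
  have h := hA.eigenvectorBasis.sum_inner_mul_inner (WithLp.toLp 2 y) (WithLp.toLp 2 x)
  simp only [EuclideanSpace.inner_eq_star_dotProduct, star_trivial] at h
  rw [← h]
  refine Finset.sum_congr rfl fun i _ => ?_
  rw [mul_comm, dotProduct_comm x]

theorem dotProduct_mulVec_comm (hA : A.IsHermitian) (x y : V → ℝ) :
    x ⬝ᵥ A *ᵥ y = y ⬝ᵥ A *ᵥ x := by
  have hT : Aᵀ = A := by simpa [conjTranspose_eq_transpose_of_trivial] using hA.eq
  rw [dotProduct_mulVec, ← mulVec_transpose, hT, dotProduct_comm]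

theorem eigenvectorBasis_dotProduct_mulVec (hA : A.IsHermitian) (i : V) (x : V → ℝ) :
    (hA.eigenvectorBasis i).ofLp ⬝ᵥ A *ᵥ x
      = hA.eigenvalues i * ((hA.eigenvectorBasis i).ofLp ⬝ᵥ x) := by
  rw [dotProduct_mulVec_comm hA, hA.mulVec_eigenvectorBasis, dotProduct_smul, dotProduct_comm,
    smul_eq_mul]

theorem dotProduct_mulVec_eq_sum_eigenvalues (hA : A.IsHermitian) (x : V → ℝ) :
    x ⬝ᵥ A *ᵥ x
      = ∑ i, hA.eigenvalues i * ((hA.eigenvectorBasis i).ofLp ⬝ᵥ x) ^ 2 := by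
  rw [eigenvectorBasis_parseval hA]
  refine Finset.sum_congr rfl fun i _ => ?_
  rw [eigenvectorBasis_dotProduct_mulVec]
  ring

theorem pow_mulVec_eigenvectorBasis (hA : A.IsHermitian) (i : V) (k : ℕ) :
    A ^ k *ᵥ (hA.eigenvectorBasis i).ofLp
      = hA.eigenvalues i ^ k • (hA.eigenvectorBasis i).ofLp := by
  induction k with
  | zero => simp
  | succ k ih =>
    rw [pow_succ, ← mulVec_mulVec, hA.mulVec_eigenvectorBasis, mulVec_smul, ih, smul_smul,
      pow_succ, mul_comm]

theorem trace_pow_eq_sum_eigenvalues_pow (hA : A.IsHermitian) (k : ℕ) :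
    (A ^ k).trace = ∑ i, hA.eigenvalues i ^ k := by
  have h : ∀ u, (A ^ k) u u = ∑ i, hA.eigenvalues i ^ k *
      ((hA.eigenvectorBasis i).ofLp u * (hA.eigenvectorBasis i).ofLp u) := by
    intro u
    have := eigenvectorBasis_parseval hA (Pi.single u 1) (A ^ k *ᵥ Pi.single u 1)
    rw [single_one_dotProduct, mulVec_single_one] at this
    rw [show (A ^ k) u u = (A ^ k).col u u from rfl, this]
    refine Finset.sum_congr rfl fun i _ => ?_
    rw [← mulVec_single_one, dotProduct_mulVec_comm (hA.pow k),
      pow_mulVec_eigenvectorBasis, dotProduct_smul]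
    simp
    ring
  rw [Matrix.trace]
  simp only [diag_apply, h]
  rw [Finset.sum_comm]
  refine Finset.sum_congr rfl fun i _ => ?_
  rw [← Finset.mul_sum]
  have h1 := hA.eigenvectorBasis.orthonormal.1 i
  have h2 : ∑ u, (hA.eigenvectorBasis i).ofLp u * (hA.eigenvectorBasis i).ofLp u = 1 := by
    have := real_inner_self_eq_norm_sq (hA.eigenvectorBasis i)
    rw [h1, EuclideanSpace.inner_eq_star_dotProduct] at this
    simpa [dotProduct] using this
  rw [h2, mul_one]

theorem finrank_eigenspace_le_card (hA : A.IsHermitian) (μ : ℝ) :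
    Module.finrank ℝ (Module.End.eigenspace (Matrix.toLin' A) μ)
      ≤ #{i | hA.eigenvalues i = μ} := by
  set s : Finset (V → ℝ) :=
    ({i | hA.eigenvalues i = μ} : Finset V).image fun i => (hA.eigenvectorBasis i).ofLp with hs
  have hle : Module.End.eigenspace (Matrix.toLin' A) μ ≤ Submodule.span ℝ (s : Set (V → ℝ)) := by
    intro f hf
    rw [Module.End.mem_eigenspace_iff, toLin'_apply] at hf
    have hsum : f = ∑ i, ((hA.eigenvectorBasis i).ofLp ⬝ᵥ f) • (hA.eigenvectorBasis i).ofLp := by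
      ext u
      have := eigenvectorBasis_parseval hA (Pi.single u 1) f
      rw [single_one_dotProduct] at this
      rw [this]
      simp [Finset.sum_apply, mul_comm]
    rw [hsum]
    refine Submodule.sum_mem _ fun i _ => ?_
    by_cases hi : hA.eigenvalues i = μ
    · refine Submodule.smul_mem _ _ (Submodule.subset_span ?_)
      simp only [hs, coe_image, Set.mem_image]
      exact ⟨i, by simp [hi], rfl⟩
    · have h1 := eigenvectorBasis_dotProduct_mulVec hA i f
      rw [hf, dotProduct_smul, smul_eq_mul] at h1
      have h2 : (hA.eigenvectorBasis i).ofLp ⬝ᵥ f = 0 := by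
        by_contra hne
        exact hi (mul_right_cancel₀ hne h1).symm
      rw [h2, zero_smul]
      exact Submodule.zero_mem _
  calc _ ≤ Module.finrank ℝ (Submodule.span ℝ (s : Set (V → ℝ))) := Submodule.finrank_mono hle
    _ ≤ #s := finrank_span_finset_le_card s
    _ ≤ _ := Finset.card_image_le

/-- The trace method for a single eigenvalue. -/
theorem finrank_eigenspace_mul_pow_le_trace (hA : A.IsHermitian) (μ : ℝ) (k : ℕ) :
    (Module.finrank ℝ (Module.End.eigenspace (Matrix.toLin' A) μ) : ℝ) * μ ^ (2 * k)
      ≤ (A ^ (2 * k)).trace := by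
  rw [trace_pow_eq_sum_eigenvalues_pow hA]
  have hnn : ∀ x : ℝ, 0 ≤ x ^ (2 * k) := fun x => by rw [pow_mul]; positivity
  calc _ ≤ (#{i | hA.eigenvalues i = μ} : ℝ) * μ ^ (2 * k) :=
        mul_le_mul_of_nonneg_right (by exact_mod_cast finrank_eigenspace_le_card hA μ) (hnn μ)
    _ = ∑ i with hA.eigenvalues i = μ, hA.eigenvalues i ^ (2 * k) := by
        rw [Finset.sum_congr rfl (g := fun _ => μ ^ (2 * k))]
        · simp
        · intro i hi
          rw [(Finset.mem_filter.1 hi).2]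
    _ ≤ _ := Finset.sum_le_sum_of_subset_of_nonneg (Finset.filter_subset _ _)
        fun i _ _ => hnn _

end Spectral

/-! ### Variational bounds for λ₂ -/

section LambdaTwo

variable {V : Type*} [Fintype V] [DecidableEq V] (G : SimpleGraph V) [DecidableRel G.Adj]

/-- The variational lower bound for `λ₂` from a two-dimensional space of test vectors. -/
theorem le_lambda2 (hn : 2 ≤ Fintype.card V) (c : ℝ) (x y : V → ℝ)
    (hind : ∀ a b : ℝ, a • x + b • y = 0 → a = 0 ∧ b = 0)
    (h : ∀ a b : ℝ, c * ((a • x + b • y) ⬝ᵥ (a • x + b • y))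
      ≤ (a • x + b • y) ⬝ᵥ G.adjMatrix ℝ *ᵥ (a • x + b • y)) :
    c ≤ lambda2 G hn := by
  set hA := G.isHermitian_adjMatrix ℝ with hAdef
  -- This must be the equivalence inside the definition of `eigenvalues`, so that `hA.eigenvalues i`
  -- unfolds to `eigenvalues₀ (e.symm i)`.
  let e := (Fintype.equivOfCardEq (Fintype.card_fin (Fintype.card V)) :
    Fin (Fintype.card V) ≃ V)
  let i0 : V := e ⟨0, by omega⟩
  have hle : ∀ i, i ≠ i0 → hA.eigenvalues i ≤ lambda2 G hn := by
    intro i hi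
    refine hA.eigenvalues₀_antitone ?_
    have : e.symm i ≠ ⟨0, by omega⟩ := fun h0 => hi (by rw [← e.apply_symm_apply i, h0])
    rw [Fin.le_def]
    have h3 : (e.symm i).val ≠ 0 := fun h0 => this (Fin.ext h0)
    change 1 ≤ (e.symm i).val
    omega
  let v := (hA.eigenvectorBasis i0).ofLp
  -- Two dimensions leave a nonzero combination orthogonal to the top eigenvector; all other
  -- eigenvalues are at most λ₂.
  obtain ⟨a, b, hab, hz⟩ : ∃ a b : ℝ, (a ≠ 0 ∨ b ≠ 0) ∧ v ⬝ᵥ (a • x + b • y) = 0 := by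
    by_cases h0 : v ⬝ᵥ x = 0
    · exact ⟨1, 0, by simp, by simp [h0]⟩
    · refine ⟨v ⬝ᵥ y, -(v ⬝ᵥ x), Or.inr (neg_ne_zero.2 h0), ?_⟩
      simp only [dotProduct_add, dotProduct_smul, smul_eq_mul]
      ring
  set z := a • x + b • y with hzdef
  have hz0 : z ≠ 0 := fun h0 => by
    have := hind a b h0
    tauto
  have hpos : 0 < z ⬝ᵥ z := by
    have h1 : 0 ≤ z ⬝ᵥ z := Finset.sum_nonneg fun i _ => mul_self_nonneg _
    exact lt_of_le_of_ne h1 fun h2 => hz0 (dotProduct_self_eq_zero.1 h2.symm)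
  have hub : z ⬝ᵥ G.adjMatrix ℝ *ᵥ z ≤ lambda2 G hn * (z ⬝ᵥ z) := by
    rw [dotProduct_mulVec_eq_sum_eigenvalues hA, eigenvectorBasis_parseval hA, Finset.mul_sum]
    refine Finset.sum_le_sum fun i _ => ?_
    by_cases hi : i = i0
    · have : (hA.eigenvectorBasis i).ofLp ⬝ᵥ z = 0 := by rw [hi]; exact hz
      simp [this]
    · rw [← pow_two]
      exact mul_le_mul_of_nonneg_right (hle i hi) (sq_nonneg _)
  exact le_of_mul_le_mul_right ((h a b).trans hub) hpos

theorem eigMultiplicity_le_card (μ : ℝ) : eigMultiplicity G μ ≤ Fintype.card V := by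
  refine (Submodule.finrank_le _).trans ?_
  simp

theorem self_dotProduct_pos_of_form_lt {A : Matrix V V ℝ} {lam : ℝ} {x : V → ℝ}
    (hx : lam * (x ⬝ᵥ x) < x ⬝ᵥ A *ᵥ x) : 0 < x ⬝ᵥ x := by
  have h1 : 0 ≤ x ⬝ᵥ x := Finset.sum_nonneg fun i _ => mul_self_nonneg _
  refine lt_of_le_of_ne h1 fun h2 => ?_
  have h0 : x = 0 := dotProduct_self_eq_zero.1 h2.symm
  simp [h0] at hx

theorem dotProduct_mulVec_add_smul {A : Matrix V V ℝ} (hA : A.IsHermitian) (x y : V → ℝ)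
    (a b : ℝ) : (a • x + b • y) ⬝ᵥ A *ᵥ (a • x + b • y)
      = a ^ 2 * (x ⬝ᵥ A *ᵥ x) + 2 * a * b * (x ⬝ᵥ A *ᵥ y) + b ^ 2 * (y ⬝ᵥ A *ᵥ y) := by
  simp only [mulVec_add, mulVec_smul, dotProduct_add, add_dotProduct, dotProduct_smul,
    smul_dotProduct, smul_eq_mul]
  rw [dotProduct_mulVec_comm hA y x]
  ring

theorem dotProduct_self_add_smul (x y : V → ℝ) (a b : ℝ) :
    (a • x + b • y) ⬝ᵥ (a • x + b • y)
      = a ^ 2 * (x ⬝ᵥ x) + 2 * a * b * (x ⬝ᵥ y) + b ^ 2 * (y ⬝ᵥ y) := by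
  simp only [dotProduct_add, add_dotProduct, dotProduct_smul, smul_dotProduct, smul_eq_mul]
  rw [dotProduct_comm y x]
  ring

/-- Two orthogonal vectors which do not interact in the quadratic form cannot both have a Rayleigh
quotient above `λ₂`. -/
theorem lt_lambda2_of_separated (hn : 2 ≤ Fintype.card V) {lam : ℝ} {x y : V → ℝ}
    (hx : lam * (x ⬝ᵥ x) < x ⬝ᵥ G.adjMatrix ℝ *ᵥ x)
    (hy : lam * (y ⬝ᵥ y) < y ⬝ᵥ G.adjMatrix ℝ *ᵥ y)
    (hxy : x ⬝ᵥ y = 0) (hAxy : x ⬝ᵥ G.adjMatrix ℝ *ᵥ y = 0) : lam < lambda2 G hn := by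
  have hx0 := self_dotProduct_pos_of_form_lt hx
  have hy0 := self_dotProduct_pos_of_form_lt hy
  set qx := x ⬝ᵥ G.adjMatrix ℝ *ᵥ x
  set qy := y ⬝ᵥ G.adjMatrix ℝ *ᵥ y
  have hlt : lam < min (qx / (x ⬝ᵥ x)) (qy / (y ⬝ᵥ y)) :=
    lt_min ((lt_div_iff₀ hx0).2 hx) ((lt_div_iff₀ hy0).2 hy)
  refine hlt.trans_le (le_lambda2 G hn _ x y ?_ ?_)
  · intro a b hab
    have h1 := dotProduct_self_add_smul x y a b
    rw [hab, hxy, dotProduct_zero] at h1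
    have h2 : a ^ 2 * (x ⬝ᵥ x) = 0 := by
      nlinarith [mul_nonneg (sq_nonneg a) hx0.le, mul_nonneg (sq_nonneg b) hy0.le]
    have h3 : b ^ 2 * (y ⬝ᵥ y) = 0 := by
      nlinarith [mul_nonneg (sq_nonneg a) hx0.le, mul_nonneg (sq_nonneg b) hy0.le]
    simpa [hx0.ne', hy0.ne'] using And.intro h2 h3
  · intro a b
    rw [dotProduct_self_add_smul, dotProduct_mulVec_add_smul (G.isHermitian_adjMatrix ℝ), hxy,
      hAxy]
    have h1 := (le_div_iff₀ hx0).1 (min_le_left (qx / (x ⬝ᵥ x)) (qy / (y ⬝ᵥ y)))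
    have h2 := (le_div_iff₀ hy0).1 (min_le_right (qx / (x ⬝ᵥ x)) (qy / (y ⬝ᵥ y)))
    nlinarith [mul_le_mul_of_nonneg_left h1 (sq_nonneg a),
      mul_le_mul_of_nonneg_left h2 (sq_nonneg b)]

theorem le_lambda2_of_pair (hn : 2 ≤ Fintype.card V) {u v : V} (huv : u ≠ v) {c : ℝ}
    (h : ∀ a b : ℝ, c * (a ^ 2 + b ^ 2) ≤ 2 * a * b * G.adjMatrix ℝ u v) :
    c ≤ lambda2 G hn := by
  refine le_lambda2 G hn c (Pi.single u 1) (Pi.single v 1) ?_ ?_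
  · intro a b hab
    have h1 := congrFun hab u
    have h2 := congrFun hab v
    simpa [huv, huv.symm] using And.intro h1 h2
  · intro a b
    rw [dotProduct_self_add_smul, dotProduct_mulVec_add_smul (G.isHermitian_adjMatrix ℝ)]
    have := h a b
    simp [huv.symm] at this ⊢
    linarith

theorem neg_one_le_lambda2 (hn : 2 ≤ Fintype.card V) : -1 ≤ lambda2 G hn := by
  obtain ⟨u, v, huv⟩ := Fintype.one_lt_card_iff.1 hn
  refine le_lambda2_of_pair G hn huv fun a b => ?_
  rw [SimpleGraph.adjMatrix_apply]
  split_ifs <;> nlinarith [sq_nonneg (a + b)]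

theorem lambda2_nonneg_of_not_adj (hn : 2 ≤ Fintype.card V) {u v : V} (huv : u ≠ v)
    (hadj : ¬ G.Adj u v) : 0 ≤ lambda2 G hn :=
  le_lambda2_of_pair G hn huv fun a b => by simp [SimpleGraph.adjMatrix_apply, hadj]

end LambdaTwo


/-! ### Quadratic forms on a vertex set, and Perron vectors -/

section LocalForm

variable {V : Type*} [Fintype V] [DecidableEq V]

/-- The quadratic form of `A` is at most `μ` times the squared norm on the vectors supported
on `s`. -/
def FormLE (A : Matrix V V ℝ) (s : Finset V) (μ : ℝ) : Prop :=
  ∀ x : V → ℝ, (∀ u, u ∉ s → x u = 0) → x ⬝ᵥ A *ᵥ x ≤ μ * (x ⬝ᵥ x)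

variable {A : Matrix V V ℝ} {s t : Finset V} {μ : ℝ}

theorem FormLE.mono (h : FormLE A t μ) (hst : s ⊆ t) : FormLE A s μ :=
  fun x hx => h x fun u hu => hx u fun hs => hu (hst hs)

theorem dotProduct_self_nonneg_real (x : V → ℝ) : 0 ≤ x ⬝ᵥ x :=
  Finset.sum_nonneg fun _ _ => mul_self_nonneg _

theorem FormLE.mono_right {ν : ℝ} (h : FormLE A s μ) (hμ : μ ≤ ν) : FormLE A s ν :=
  fun x hx => (h x hx).trans (mul_le_mul_of_nonneg_right hμ (dotProduct_self_nonneg_real x))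

theorem dotProduct_mulVec_eq_sum (x y : V → ℝ) :
    x ⬝ᵥ A *ᵥ y = ∑ u, ∑ w, x u * A u w * y w := by
  simp only [dotProduct, mulVec, Finset.mul_sum, mul_assoc]

theorem abs_dotProduct_abs (x : V → ℝ) : |x| ⬝ᵥ |x| = x ⬝ᵥ x := by
  simp [dotProduct, Pi.abs_apply]

theorem abs_form_le_form_abs (hnn : ∀ u w, 0 ≤ A u w) (x : V → ℝ) :
    |x ⬝ᵥ A *ᵥ x| ≤ |x| ⬝ᵥ A *ᵥ |x| := by
  rw [dotProduct_mulVec_eq_sum, dotProduct_mulVec_eq_sum]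
  refine (Finset.abs_sum_le_sum_abs _ _).trans (Finset.sum_le_sum fun u _ => ?_)
  refine (Finset.abs_sum_le_sum_abs _ _).trans (Finset.sum_le_sum fun w _ => ?_)
  rw [abs_mul, abs_mul, abs_of_nonneg (hnn u w), Pi.abs_apply, Pi.abs_apply]

theorem FormLE.neg_le (h : FormLE A s μ) (hnn : ∀ u w, 0 ≤ A u w) {x : V → ℝ}
    (hx : ∀ u, u ∉ s → x u = 0) : -(x ⬝ᵥ A *ᵥ x) ≤ μ * (x ⬝ᵥ x) := by
  rw [← abs_dotProduct_abs x]
  exact ((neg_le_abs _).trans (abs_form_le_form_abs hnn x)).trans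
    (h |x| fun u hu => by simp [hx u hu])

/-- A symmetric nonnegative matrix with quadratic form at most `μ` on `s` has operator norm at most
`μ` there. -/
theorem FormLE.mulVec_self_le (h : FormLE A s μ) (hA : A.IsHermitian)
    (hnn : ∀ u w, 0 ≤ A u w) (hμ : 0 < μ) {y : V → ℝ} (hy : ∀ u, u ∉ s → y u = 0)
    (hAy : ∀ u, u ∉ s → (A *ᵥ y) u = 0) :
    (A *ᵥ y) ⬝ᵥ (A *ᵥ y) ≤ μ ^ 2 * (y ⬝ᵥ y) := by
  set w := A *ᵥ y with hw
  -- Adding the upper bound at `w + μy` to the lower bound at `w - μy` cancels the forms at `w` and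
  -- at `y` and the product `w ⬝ᵥ y`.
  have h1 := h ((1 : ℝ) • w + μ • y) fun u hu => by simp [hy u hu, hAy u hu]
  have h2 := h.neg_le hnn (x := (1 : ℝ) • w + (-μ) • y) fun u hu => by simp [hy u hu, hAy u hu]
  rw [dotProduct_self_add_smul, dotProduct_mulVec_add_smul hA, ← hw] at h1 h2
  have h3 : μ * (w ⬝ᵥ w) ≤ μ * (μ ^ 2 * (y ⬝ᵥ y)) := by nlinarith
  exact le_of_mul_le_mul_left h3 hμ

/-- The first variation at a maximizer of the quadratic form. -/
theorem FormLE.mulVec_eq_of_eq (h : FormLE A s μ) (hA : A.IsHermitian) {x : V → ℝ}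
    (hx : ∀ u, u ∉ s → x u = 0) (heq : x ⬝ᵥ A *ᵥ x = μ * (x ⬝ᵥ x)) {u : V} (hu : u ∈ s) :
    (A *ᵥ x) u = μ * x u := by
  have key : ∀ c : ℝ, 2 * c * ((A *ᵥ x) u - μ * x u) ≤ c ^ 2 * (μ - A u u) := by
    intro c
    have h1 := h ((1 : ℝ) • x + c • Pi.single u 1) fun w hw => by
      have : w ≠ u := fun h => hw (h ▸ hu)
      simp [hx w hw, this]
    have h2 : x ⬝ᵥ A *ᵥ Pi.single u 1 = (A *ᵥ x) u := by
      rw [dotProduct_mulVec_comm hA, single_one_dotProduct]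
    have h3 : Pi.single u 1 ⬝ᵥ A *ᵥ Pi.single u 1 = A u u := by
      rw [single_one_dotProduct, mulVec_single_one]; rfl
    rw [dotProduct_self_add_smul, dotProduct_mulVec_add_smul hA, h2, h3, heq,
      dotProduct_single_one, single_one_dotProduct, Pi.single_eq_same] at h1
    linarith
  set d := (A *ᵥ x) u - μ * x u with hd
  have : d = 0 := by
    set M := |μ - A u u| + 1 with hM
    have hM0 : 0 < M := by positivity
    have hMle : μ - A u u ≤ M := (le_abs_self _).trans (by linarith)
    -- Since `M` exceeds `μ - A u u`, this choice of `c` gives `2d²/M ≤ d²/M`.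
    have h1 := key (d / M)
    have h2 : (d / M) ^ 2 * (μ - A u u) ≤ (d / M) ^ 2 * M :=
      mul_le_mul_of_nonneg_left hMle (sq_nonneg _)
    have h3 : (d / M) ^ 2 * M = d ^ 2 / M := by field_simp
    have h4 : 2 * (d / M) * d = 2 * (d ^ 2 / M) := by ring
    have h5 : d ^ 2 / M ≤ 0 := by linarith
    have h6 : d ^ 2 ≤ 0 := by
      by_contra hlt
      exact absurd h5 (not_le.2 (div_pos (not_le.1 hlt) hM0))
    exact pow_eq_zero_iff two_ne_zero |>.1 (le_antisymm h6 (sq_nonneg _))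
  linarith

/-- A nonnegative maximizer of the quadratic form of a nonnegative matrix on `s`. -/
theorem exists_perron_vector (hnn : ∀ u w, 0 ≤ A u w) (hs : s.Nonempty) :
    ∃ (μ : ℝ) (x : V → ℝ), (∀ u, 0 ≤ x u) ∧ (∀ u, u ∉ s → x u = 0) ∧ x ⬝ᵥ x = 1 ∧
      x ⬝ᵥ A *ᵥ x = μ ∧ FormLE A s μ := by
  let K : Set (V → ℝ) := {x | (∀ u, u ∉ s → x u = 0) ∧ x ⬝ᵥ x = 1}
  have hcd : Continuous fun x : V → ℝ => x ⬝ᵥ x := by unfold dotProduct; fun_prop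
  have hcf : Continuous fun x : V → ℝ => x ⬝ᵥ A *ᵥ x := by
    simp only [dotProduct_mulVec_eq_sum]; fun_prop
  have hKc : IsClosed K := by
    have hK : K = (⋂ u, ⋂ _ : u ∉ s, {x | x u = 0}) ∩ {x | x ⬝ᵥ x = 1} := by
      ext x; simp [K]
    rw [hK]
    refine IsClosed.inter ?_ (isClosed_eq hcd continuous_const)
    exact isClosed_iInter fun u => isClosed_iInter fun _ =>
      isClosed_eq (continuous_apply u) continuous_const
  have hKcomp : IsCompact K := by
    refine IsCompact.of_isClosed_subset (isCompact_Icc (a := fun _ : V => (-1 : ℝ))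
      (b := fun _ => 1)) hKc ?_
    rintro x ⟨-, hx⟩
    have : ∀ u, x u ^ 2 ≤ 1 := by
      intro u
      rw [← hx, pow_two]
      exact Finset.single_le_sum (f := fun u => x u * x u) (fun _ _ => mul_self_nonneg _)
        (Finset.mem_univ u)
    exact ⟨fun u => (abs_le.1 ((sq_le_one_iff_abs_le_one _).1 (this u))).1,
      fun u => (abs_le.1 ((sq_le_one_iff_abs_le_one _).1 (this u))).2⟩
  obtain ⟨w, hw⟩ := hs
  have hKne : K.Nonempty := by
    refine ⟨Pi.single w 1, fun u hu => ?_, by simp⟩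
    have : u ≠ w := fun h => hu (h ▸ hw)
    simp [this]
  obtain ⟨x, ⟨hxs, hx1⟩, hmax⟩ := hKcomp.exists_isMaxOn hKne hcf.continuousOn
  have habsK : |x| ∈ K := ⟨fun u hu => by simp [hxs u hu], by rw [abs_dotProduct_abs, hx1]⟩
  refine ⟨|x| ⬝ᵥ A *ᵥ |x|, |x|, fun u => abs_nonneg _, habsK.1, habsK.2, rfl, fun y hy => ?_⟩
  by_cases hy0 : y = 0
  · simp [hy0]
  have hpos : 0 < y ⬝ᵥ y := lt_of_le_of_ne (dotProduct_self_nonneg_real y)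
    fun h => hy0 (dotProduct_self_eq_zero.1 h.symm)
  set r := Real.sqrt (y ⬝ᵥ y)
  have hr : 0 < r := Real.sqrt_pos.2 hpos
  have hr2 : r ^ 2 = y ⬝ᵥ y := Real.sq_sqrt hpos.le
  have hyK : r⁻¹ • y ∈ K := by
    refine ⟨fun u hu => by simp [hy u hu], ?_⟩
    rw [smul_dotProduct, dotProduct_smul, ← hr2]
    simp only [smul_eq_mul]
    field_simp
  have h1 : (r⁻¹ • y) ⬝ᵥ A *ᵥ (r⁻¹ • y) ≤ x ⬝ᵥ A *ᵥ x := hmax hyK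
  have h2 := (le_abs_self _).trans (abs_form_le_form_abs hnn x)
  have h3 := h1.trans h2
  rw [mulVec_smul, smul_dotProduct, dotProduct_smul, smul_eq_mul, smul_eq_mul] at h3
  rw [← hr2]
  have h4 : y ⬝ᵥ A *ᵥ y = r ^ 2 * (r⁻¹ * (r⁻¹ * (y ⬝ᵥ A *ᵥ y))) := by field_simp
  rw [h4, mul_comm _ (r ^ 2)]
  exact mul_le_mul_of_nonneg_left h3 (sq_nonneg _)

end LocalForm

/-! ### Balls: growth and closed walks -/

section ClosedBall

variable {V : Type*} [Fintype V] [DecidableEq V] (G : SimpleGraph V)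

open Classical in
/-- The vertices at distance at most `k` from `v`. -/
noncomputable def closedBall (k : ℕ) (v : V) : Finset V := {u | G.edist v u ≤ k}

variable {G}

@[simp]
theorem mem_closedBall {k : ℕ} {u v : V} : u ∈ closedBall G k v ↔ G.edist v u ≤ k := by
  simp [closedBall]

theorem self_mem_closedBall (k : ℕ) (v : V) : v ∈ closedBall G k v := by simp

theorem closedBall_mono {j k : ℕ} (h : j ≤ k) (v : V) : closedBall G j v ⊆ closedBall G k v :=
  fun u hu => by
    rw [mem_closedBall] at *
    exact hu.trans (by exact_mod_cast h)

theorem edist_le_one_of_adj {u v : V} (h : G.Adj u v) : G.edist u v ≤ 1 :=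
  (SimpleGraph.edist_eq_one_iff_adj.2 h).le

theorem mem_closedBall_of_adj {k : ℕ} {u v w : V} (hu : u ∈ closedBall G k v) (h : G.Adj u w) :
    w ∈ closedBall G (k + 1) v := by
  rw [mem_closedBall] at *
  push_cast
  exact G.edist_triangle.trans (add_le_add hu (edist_le_one_of_adj h))

theorem mem_closedBall_comm {k : ℕ} {u v : V} : u ∈ closedBall G k v ↔ v ∈ closedBall G k u := by
  rw [mem_closedBall, mem_closedBall, SimpleGraph.edist_comm]

/-- A point at distance at most `k + 1` is reached through a neighbour. -/
theorem exists_adj_of_mem_closedBall_succ {k : ℕ} {u v : V}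
    (h : u ∈ closedBall G (k + 1) v) : u = v ∨ ∃ w, G.Adj v w ∧ u ∈ closedBall G k w := by
  rw [mem_closedBall] at h
  have hr : G.Reachable v u := SimpleGraph.reachable_of_edist_ne_top
    (fun ht => by rw [ht] at h; exact absurd h (by simp))
  obtain ⟨p, hp⟩ := hr.exists_walk_length_eq_edist
  rw [← hp] at h
  cases p with
  | nil => exact Or.inl rfl
  | cons hadj q =>
    refine Or.inr ⟨_, hadj, ?_⟩
    rw [mem_closedBall]
    refine (SimpleGraph.edist_le q).trans ?_
    simp only [SimpleGraph.Walk.length_cons] at h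
    have h' : q.length + 1 ≤ k + 1 := by exact_mod_cast h
    exact_mod_cast Nat.le_of_succ_le_succ h'

theorem mem_closedBall_one {u v : V} : u ∈ closedBall G 1 v ↔ u = v ∨ G.Adj v u := by
  constructor
  · intro h
    rcases exists_adj_of_mem_closedBall_succ (k := 0) h with h | ⟨w, hw, hu⟩
    · exact Or.inl h
    · simp at hu
      exact Or.inr (hu ▸ hw)
  · rintro (rfl | h)
    · exact self_mem_closedBall _ _
    · exact mem_closedBall_of_adj (self_mem_closedBall 0 v) h

variable [DecidableRel G.Adj]

/-- The subtracted 1 closes the induction: `Δ(Δ^(k+1) - 1) + 1 ≤ Δ^(k+2) - 1` because `Δ ≥ 2`. -/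
theorem card_closedBall_le {Δ : ℝ} (hΔ : 2 ≤ Δ) (hdeg : (G.maxDegree : ℝ) ≤ Δ) (k : ℕ) (v : V) :
    (#(closedBall G k v) : ℝ) ≤ Δ ^ (k + 1) - 1 := by
  induction k generalizing v with
  | zero =>
    have : closedBall G 0 v = {v} := by
      ext u
      rw [mem_closedBall, Nat.cast_zero, nonpos_iff_eq_zero, SimpleGraph.edist_eq_zero_iff,
        mem_singleton, eq_comm]
    rw [this]
    simp
    linarith
  | succ k ih =>
    have hsub : closedBall G (k + 1) v
        ⊆ insert v ((G.neighborFinset v).biUnion fun w => closedBall G k w) := by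
      intro u hu
      rcases exists_adj_of_mem_closedBall_succ hu with h | ⟨w, hw, hu⟩
      · simp [h]
      · refine Finset.mem_insert_of_mem (Finset.mem_biUnion.2 ⟨w, by simpa using hw, hu⟩)
    have h1 : (#(closedBall G (k + 1) v) : ℝ)
        ≤ ∑ w ∈ G.neighborFinset v, (#(closedBall G k w) : ℝ) + 1 := by
      have := (Finset.card_le_card hsub).trans (Finset.card_insert_le _ _)
      have := this.trans (Nat.add_le_add_right Finset.card_biUnion_le 1)
      exact_mod_cast this
    have h2 : ∑ w ∈ G.neighborFinset v, (#(closedBall G k w) : ℝ)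
        ≤ Δ * (Δ ^ (k + 1) - 1) := by
      refine (Finset.sum_le_sum fun w _ => ih w).trans ?_
      rw [Finset.sum_const, nsmul_eq_mul, SimpleGraph.card_neighborFinset_eq_degree]
      refine mul_le_mul_of_nonneg_right ?_ ?_
      · exact (by exact_mod_cast G.degree_le_maxDegree v : (G.degree v : ℝ) ≤ G.maxDegree).trans
          hdeg
      · have := one_le_pow₀ (show (1 : ℝ) ≤ Δ by linarith) (n := k + 1)
        linarith
    calc _ ≤ Δ * (Δ ^ (k + 1) - 1) + 1 := by linarith
      _ ≤ _ := by rw [pow_succ Δ (k + 1)]; linarith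

theorem adjMatrix_nonneg (u w : V) : 0 ≤ G.adjMatrix ℝ u w := by
  rw [SimpleGraph.adjMatrix_apply]; split_ifs <;> norm_num

theorem mulVec_adjMatrix_eq_zero {k : ℕ} {v : V} {x : V → ℝ}
    (hx : ∀ u, u ∉ closedBall G k v → x u = 0) {u : V} (hu : u ∉ closedBall G (k + 1) v) :
    (G.adjMatrix ℝ *ᵥ x) u = 0 := by
  rw [SimpleGraph.adjMatrix_mulVec_apply]
  refine Finset.sum_eq_zero fun w hw => hx w fun hw' => hu ?_
  exact mem_closedBall_of_adj hw' ((G.mem_neighborFinset _ _).1 hw).symm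

/-- A local bound on the quadratic form bounds the number of closed walks. -/
theorem FormLE.adjMatrix_pow_diag_le {μ : ℝ} {k : ℕ} {v : V}
    (h : FormLE (G.adjMatrix ℝ) (closedBall G k v) μ) (hμ : 0 < μ) :
    (G.adjMatrix ℝ ^ (2 * k)) v v ≤ μ ^ (2 * k) := by
  have hA := G.isHermitian_adjMatrix ℝ
  set e : V → ℝ := Pi.single v 1 with he
  -- The diagonal entry is the squared norm of `A^k e`. Up to step `k` the iterates stay inside the
  -- ball, where applying `A` stretches by at most `μ`.
  have key : ∀ j ≤ k, (∀ u, u ∉ closedBall G j v → (G.adjMatrix ℝ ^ j *ᵥ e) u = 0) ∧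
      (G.adjMatrix ℝ ^ j *ᵥ e) ⬝ᵥ (G.adjMatrix ℝ ^ j *ᵥ e) ≤ μ ^ (2 * j) := by
    intro j
    induction j with
    | zero =>
      intro _
      rw [pow_zero, one_mulVec]
      refine ⟨fun u hu => ?_, by simp [he]⟩
      have : u ≠ v := by
        intro huv
        rw [huv] at hu
        exact hu (self_mem_closedBall 0 v)
      simp [he, this]
    | succ j ih =>
      intro hj
      obtain ⟨h1, h2⟩ := ih (by omega)
      rw [pow_succ', ← mulVec_mulVec]
      have h3 : ∀ u, u ∉ closedBall G (j + 1) v →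
          (G.adjMatrix ℝ *ᵥ (G.adjMatrix ℝ ^ j *ᵥ e)) u = 0 := by
        intro u hu
        apply mulVec_adjMatrix_eq_zero (k := j) (v := v) _ hu
        exact h1
      refine ⟨h3, ?_⟩
      have h4 := h.mulVec_self_le hA adjMatrix_nonneg hμ
        (fun u hu => h1 u fun hu' => hu (closedBall_mono (by omega) v hu'))
        (fun u hu => h3 u fun hu' => hu (closedBall_mono hj v hu'))
      refine h4.trans ?_
      rw [show 2 * (j + 1) = 2 + 2 * j by ring, pow_add]
      exact mul_le_mul_of_nonneg_left h2 (sq_nonneg _)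
  refine le_of_eq_of_le ?_ (key k le_rfl).2
  rw [dotProduct_mulVec_comm (hA.pow k), mulVec_mulVec, ← pow_add, ← two_mul, he,
    single_one_dotProduct, mulVec_single_one]
  rfl

end ClosedBall


/-! ### Deleting vertices while keeping the vertex type -/

section Isolate

variable {V : Type*} [Fintype V] [DecidableEq V]

/-- The graph obtained from `G` by deleting all edges meeting `Q`. -/
def isolate (G : SimpleGraph V) (Q : Finset V) : SimpleGraph V where
  Adj u w := G.Adj u w ∧ u ∉ Q ∧ w ∉ Q
  symm := ⟨fun _ _ h => ⟨h.1.symm, h.2.2, h.2.1⟩⟩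
  loopless := ⟨fun _ h => G.irrefl h.1⟩

variable (G : SimpleGraph V) [DecidableRel G.Adj] (Q : Finset V)

instance : DecidableRel (isolate G Q).Adj :=
  fun u w => inferInstanceAs (Decidable (G.Adj u w ∧ u ∉ Q ∧ w ∉ Q))

variable {G Q}

theorem isolate_adj {u w : V} : (isolate G Q).Adj u w ↔ G.Adj u w ∧ u ∉ Q ∧ w ∉ Q := Iff.rfl

theorem adjMatrix_isolate_apply (u w : V) :
    (isolate G Q).adjMatrix ℝ u w = if u ∉ Q ∧ w ∉ Q then G.adjMatrix ℝ u w else 0 := by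
  simp only [SimpleGraph.adjMatrix_apply, isolate_adj]
  split_ifs <;> tauto

theorem adjMatrix_isolate_mulVec_of_mem (x : V → ℝ) {u : V} (hu : u ∈ Q) :
    ((isolate G Q).adjMatrix ℝ *ᵥ x) u = 0 := by
  simp [mulVec, dotProduct, isolate_adj, hu]

theorem adjMatrix_isolate_mulVec {x : V → ℝ} (hx : ∀ u ∈ Q, x u = 0) {u : V} (hu : u ∉ Q) :
    ((isolate G Q).adjMatrix ℝ *ᵥ x) u = (G.adjMatrix ℝ *ᵥ x) u := by
  simp only [mulVec, dotProduct, adjMatrix_isolate_apply]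
  refine Finset.sum_congr rfl fun w _ => ?_
  by_cases hw : w ∈ Q
  · simp [hx w hw]
  · simp [hu, hw]

theorem adjMatrix_isolate_pow_diag_of_mem {t : ℕ} (ht : 1 ≤ t) {u : V} (hu : u ∈ Q) :
    ((isolate G Q).adjMatrix ℝ ^ t) u u = 0 := by
  rw [← Nat.sub_add_cancel ht, pow_succ', mul_apply]
  exact Finset.sum_eq_zero fun w _ => by rw [adjMatrix_isolate_apply]; simp [hu]

theorem eq_of_mem_closedBall_isolate {k : ℕ} {u v : V} (hu : u ∈ closedBall (isolate G Q) k v)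
    (huQ : u ∈ Q) : u = v := by
  rw [mem_closedBall_comm] at hu
  rcases exists_adj_of_mem_closedBall_succ (closedBall_mono (Nat.le_succ k) u hu) with
    h | ⟨w, hw, -⟩
  · exact h.symm
  · exact absurd huQ hw.2.1

theorem closedBall_isolate_subset {k : ℕ} {v : V} (hv : v ∉ Q) :
    closedBall (isolate G Q) k v ⊆ closedBall G k v \ Q := by
  intro u hu
  refine Finset.mem_sdiff.2 ⟨?_, fun huQ => hv (eq_of_mem_closedBall_isolate hu huQ ▸ huQ)⟩
  rw [mem_closedBall] at *
  exact (SimpleGraph.edist_anti (show isolate G Q ≤ G from fun _ _ h => h.1)).trans hu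

/-- A deleted vertex is alone in its ball, where the form vanishes, so only centres outside `Q` need
a hypothesis; around those, the new ball lies in the old one minus `Q`. -/
theorem FormLE.isolate {μ : ℝ} (hμ : 0 ≤ μ) {k : ℕ} {v : V}
    (h : v ∉ Q → FormLE (G.adjMatrix ℝ) (closedBall G k v \ Q) μ) :
    FormLE ((isolate G Q).adjMatrix ℝ) (closedBall (isolate G Q) k v) μ := by
  intro x hx
  by_cases hv : v ∈ Q
  · have h0 : x ⬝ᵥ (SecondEigenvalue.isolate G Q).adjMatrix ℝ *ᵥ x = 0 := by
      refine Finset.sum_eq_zero fun u _ => ?_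
      by_cases hu : u ∈ Q
      · rw [adjMatrix_isolate_mulVec_of_mem x hu, mul_zero]
      · rw [hx u fun hu' => hu ?_, zero_mul]
        rw [mem_closedBall_comm] at hu'
        exact eq_of_mem_closedBall_isolate hu' hv ▸ hv
    rw [h0]
    exact mul_nonneg hμ (dotProduct_self_nonneg_real x)
  · have hsub := closedBall_isolate_subset (G := G) (k := k) hv
    have hx' : ∀ u, u ∉ closedBall G k v \ Q → x u = 0 := fun u hu => hx u fun hu' => hu (hsub hu')
    refine le_of_eq_of_le ?_ (h hv x hx')
    refine Finset.sum_congr rfl fun u _ => ?_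
    by_cases hu : u ∈ Q
    · rw [hx' u (by simp [hu]), zero_mul, zero_mul]
    · rw [adjMatrix_isolate_mulVec (fun w hw => hx' w (by simp [hw])) hu]

/-- Deleting `Q` costs at most `#Q₀` in the multiplicity, if eigenvectors vanishing on `Q₀` vanish
on `Q`. -/
theorem eigMultiplicity_le_add_isolate {lam : ℝ} {Q₀ : Finset V}
    (hQ : ∀ f : V → ℝ, G.adjMatrix ℝ *ᵥ f = lam • f → (∀ u ∈ Q₀, f u = 0) → ∀ u ∈ Q, f u = 0) :
    eigMultiplicity G lam ≤ #Q₀ + eigMultiplicity (isolate G Q) lam := by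
  set E := Module.End.eigenspace (Matrix.toLin' (G.adjMatrix ℝ)) lam with hE
  -- Rank-nullity for restricting the eigenspace to `Q₀`: the range costs `#Q₀`, and the kernel
  -- vanishes on all of `Q`, hence consists of eigenvectors of the isolated graph.
  let ρ : E →ₗ[ℝ] (Q₀ → ℝ) := (LinearMap.funLeft ℝ ℝ (Subtype.val : Q₀ → V)).domRestrict E
  have h1 := LinearMap.finrank_range_add_finrank_ker ρ
  have h2 : Module.finrank ℝ (LinearMap.range ρ) ≤ #Q₀ := by
    refine (Submodule.finrank_le _).trans ?_
    simp
  have h3 : Module.finrank ℝ (LinearMap.ker ρ) ≤ eigMultiplicity (isolate G Q) lam := by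
    rw [← Submodule.finrank_map_subtype_eq E (LinearMap.ker ρ)]
    refine Submodule.finrank_mono ?_
    rintro f ⟨⟨g, hg⟩, hgker, rfl⟩
    have hgE : G.adjMatrix ℝ *ᵥ g = lam • g := by
      rw [← toLin'_apply]; exact Module.End.mem_eigenspace_iff.1 hg
    have hg0 : ∀ u ∈ Q₀, g u = 0 := fun u hu => congrFun (LinearMap.mem_ker.1 hgker) ⟨u, hu⟩
    have hgQ := hQ g hgE hg0
    rw [Module.End.mem_eigenspace_iff, toLin'_apply]
    ext u
    change ((isolate G Q).adjMatrix ℝ *ᵥ g) u = lam * g u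
    by_cases hu : u ∈ Q
    · rw [adjMatrix_isolate_mulVec_of_mem g hu, hgQ u hu, mul_zero]
    · rw [adjMatrix_isolate_mulVec hgQ hu, hgE]
      rfl
  change Module.finrank ℝ E ≤ _
  omega

end Isolate

/-! ### Few balls exceed λ₂ -/

section Exceptional

variable {V : Type*} [Fintype V] [DecidableEq V] (G : SimpleGraph V) [DecidableRel G.Adj]

/-- Outside of a small set of vertices, all balls have quadratic form at most `λ₂`. -/
theorem exists_exceptional_set (hn : 2 ≤ Fintype.card V) {Δ : ℝ} (hΔ : 2 ≤ Δ)
    (hdeg : (G.maxDegree : ℝ) ≤ Δ) (k : ℕ) :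
    ∃ U : Finset V, (#U : ℝ) ≤ Δ ^ (2 * k + 2) ∧
      ∀ v, v ∉ U → FormLE (G.adjMatrix ℝ) (closedBall G k v) (lambda2 G hn) := by
  classical
  refine ⟨({v | ¬ FormLE (G.adjMatrix ℝ) (closedBall G k v) (lambda2 G hn)} : Finset V), ?_,
    fun v hv => by simpa using hv⟩
  set U := ({v | ¬ FormLE (G.adjMatrix ℝ) (closedBall G k v) (lambda2 G hn)} : Finset V) with hU
  rcases U.eq_empty_or_nonempty with h0 | ⟨u, hu⟩
  · rw [h0]
    simp only [card_empty, Nat.cast_zero]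
    positivity
  -- Centres more than `2k+1` apart have balls that neither meet nor are joined by an edge;
  -- separated test vectors would then give `λ₂ < λ₂`.
  have hsub : U ⊆ closedBall G (2 * k + 1) u := by
    intro v hv
    by_contra hfar
    simp only [hU, Finset.mem_filter, Finset.mem_univ, true_and, FormLE, not_forall, not_le,
      exists_prop] at hu hv
    obtain ⟨x, hxs, hx⟩ := hu
    obtain ⟨y, hys, hy⟩ := hv
    have hsep : ∀ a b, x a ≠ 0 → y b ≠ 0 → ¬ G.edist a b ≤ 1 := by
      intro a b ha hb hab
      have ha' : a ∈ closedBall G k u := by by_contra h; exact ha (hxs a h)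
      have hb' : b ∈ closedBall G k v := by by_contra h; exact hb (hys b h)
      rw [mem_closedBall] at ha' hb' hfar
      rw [SimpleGraph.edist_comm] at hb'
      refine hfar ?_
      calc G.edist u v ≤ G.edist u a + G.edist a v := G.edist_triangle
        _ ≤ G.edist u a + (G.edist a b + G.edist b v) := by gcongr; exact G.edist_triangle
        _ ≤ k + (1 + k) := by gcongr
        _ = ((2 * k + 1 : ℕ) : ℕ∞) := by push_cast; ring
    refine lt_irrefl _ (lt_lambda2_of_separated G hn hx hy ?_ ?_)
    · refine Finset.sum_eq_zero fun a _ => ?_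
      by_contra h
      exact hsep a a (left_ne_zero_of_mul h) (right_ne_zero_of_mul h) (by simp)
    · rw [dotProduct_mulVec_eq_sum]
      refine Finset.sum_eq_zero fun a _ => Finset.sum_eq_zero fun b _ => ?_
      by_contra h
      refine hsep a b (left_ne_zero_of_mul (left_ne_zero_of_mul h)) (right_ne_zero_of_mul h) ?_
      refine edist_le_one_of_adj ?_
      by_contra hab
      exact h (by simp [SimpleGraph.adjMatrix_apply, hab])
  have h1 := card_closedBall_le hΔ hdeg (2 * k + 1) u
  have h2 : (#U : ℝ) ≤ #(closedBall G (2 * k + 1) u) := by exact_mod_cast Finset.card_le_card hsub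
  linarith

/-- Reduction to graphs in which every ball has quadratic form at most `λ₂`. -/
theorem exists_isolate_locally_bounded (hn : 2 ≤ Fintype.card V) {Δ : ℝ} (hΔ : 2 ≤ Δ)
    (hdeg : (G.maxDegree : ℝ) ≤ Δ) (h0 : 0 ≤ lambda2 G hn) (k : ℕ) :
    ∃ U : Finset V, (#U : ℝ) ≤ Δ ^ (2 * k + 2) ∧
      eigMultiplicity G (lambda2 G hn) ≤ #U + eigMultiplicity (isolate G U) (lambda2 G hn) ∧
      ∀ v, FormLE ((isolate G U).adjMatrix ℝ) (closedBall (isolate G U) k v) (lambda2 G hn) := by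
  obtain ⟨U, hcard, hU⟩ := exists_exceptional_set G hn hΔ hdeg k
  exact ⟨U, hcard, eigMultiplicity_le_add_isolate fun f _ h => h,
    fun v => FormLE.isolate h0 fun hv => (hU v hv).mono Finset.sdiff_subset⟩

end Exceptional


/-! ### Random deletion and counting surviving walks -/

section RandomDeletion

variable {V : Type*} [Fintype V] [DecidableEq V]

/-- The probability of the set `Q` when every vertex is chosen independently with
probability `p`. -/
noncomputable def bernoulliWeight (p : ℝ) (Q : Finset V) : ℝ :=
  p ^ #Q * (1 - p) ^ (Fintype.card V - #Q)

theorem bernoulliWeight_nonneg {p : ℝ} (h0 : 0 ≤ p) (h1 : p ≤ 1) (Q : Finset V) :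
    0 ≤ bernoulliWeight p Q :=
  mul_nonneg (pow_nonneg h0 _) (pow_nonneg (by linarith) _)

theorem sum_bernoulliWeight_disjoint (p : ℝ) (W : Finset V) :
    ∑ Q : Finset V, (if Disjoint W Q then bernoulliWeight p Q else 0) = (1 - p) ^ #W := by
  rw [← Finset.sum_filter]
  have hset : (Finset.univ.filter fun Q : Finset V => Disjoint W Q) = Wᶜ.powerset := by
    ext Q
    simp [Finset.subset_compl_comm, Finset.subset_compl_iff_disjoint_right]
  rw [hset]
  have h := Finset.sum_pow_mul_eq_add_pow p (1 - p) Wᶜ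
  rw [add_sub_cancel, one_pow] at h
  suffices hs : ∑ Q ∈ Wᶜ.powerset, bernoulliWeight p Q
      = ∑ Q ∈ Wᶜ.powerset, (1 - p) ^ #W * (p ^ #Q * (1 - p) ^ (#Wᶜ - #Q)) by
    rw [hs, ← Finset.mul_sum, h, mul_one]
  refine Finset.sum_congr rfl fun Q hQ => ?_
  have h1 := Finset.card_le_card (Finset.mem_powerset.1 hQ)
  have h2 := Finset.card_compl_add_card W
  rw [bernoulliWeight, show Fintype.card V - #Q = #W + (#Wᶜ - #Q) by omega, pow_add]
  ring

theorem sum_bernoulliWeight (p : ℝ) : ∑ Q : Finset V, bernoulliWeight p Q = 1 := by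
  simpa using sum_bernoulliWeight_disjoint p (∅ : Finset V)

theorem sum_bernoulliWeight_mul_card (p : ℝ) :
    ∑ Q : Finset V, bernoulliWeight p Q * (#Q : ℝ) = Fintype.card V * p := by
  have h1 : ∀ Q : Finset V, bernoulliWeight p Q * (#Q : ℝ)
      = ∑ v : V, (bernoulliWeight p Q - if Disjoint {v} Q then bernoulliWeight p Q else 0) := by
    intro Q
    have : ∀ v, (bernoulliWeight p Q - if Disjoint {v} Q then bernoulliWeight p Q else 0)
        = if v ∈ Q then bernoulliWeight p Q else 0 := by
      intro v
      simp only [Finset.disjoint_singleton_left]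
      split_ifs <;> simp_all
    simp only [this, Finset.sum_ite_mem, Finset.univ_inter, Finset.sum_const, nsmul_eq_mul]
    ring
  simp only [h1]
  rw [Finset.sum_comm]
  simp only [Finset.sum_sub_distrib, sum_bernoulliWeight, sum_bernoulliWeight_disjoint,
    Finset.card_singleton, pow_one, Finset.sum_const, Finset.card_univ, nsmul_eq_mul]
  ring

variable (G : SimpleGraph V) [DecidableRel G.Adj]

/-- One step of a walk that has visited `W`, with weight `c` for every vertex it may still discover.
Returning to `W` offers at most `r` choices at unchanged weight; a new vertex offers at most `D`
choices and uses up one factor `c`. Each step therefore contributes `r + D/c`. -/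
theorem sum_adjMatrix_insert_le {D c : ℝ} (hdeg : ∀ u, (G.degree u : ℝ) ≤ D) (hc : 0 < c)
    {b : ℝ} (hb : 0 ≤ b) {r : ℕ} (W : Finset V) (u : V) :
    ∑ w, G.adjMatrix ℝ u w *
        (if #(insert w W) ≤ r then c ^ (r - #(insert w W)) * b else 0)
      ≤ if #W ≤ r then c ^ (r - #W) * ((r + D / c) * b) else 0 := by
  split_ifs with hW
  swap
  · refine le_of_eq (Finset.sum_eq_zero fun w _ => ?_)
    have := Finset.card_le_card (Finset.subset_insert w W)
    rw [if_neg (by omega), mul_zero]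
  have hterm : ∀ w, G.adjMatrix ℝ u w *
        (if #(insert w W) ≤ r then c ^ (r - #(insert w W)) * b else 0)
      ≤ (if w ∈ W then 1 else 0) * (c ^ (r - #W) * b)
        + G.adjMatrix ℝ u w * (c ^ (r - #W) * (b / c)) := by
    intro w
    have hnn := adjMatrix_nonneg (G := G) u w
    have hle : G.adjMatrix ℝ u w ≤ 1 := by
      rw [SimpleGraph.adjMatrix_apply]; split_ifs <;> norm_num
    by_cases hw : w ∈ W
    · rw [Finset.insert_eq_of_mem hw, if_pos hW, if_pos hw]
      have : 0 ≤ G.adjMatrix ℝ u w * (c ^ (r - #W) * (b / c)) := by positivity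
      have h2 : G.adjMatrix ℝ u w * (c ^ (r - #W) * b) ≤ 1 * (c ^ (r - #W) * b) :=
        mul_le_mul_of_nonneg_right hle (by positivity)
      linarith
    · rw [if_neg hw, zero_mul, zero_add, Finset.card_insert_of_notMem hw]
      refine mul_le_mul_of_nonneg_left ?_ hnn
      split_ifs with h
      · rw [show r - #W = (r - (#W + 1)) + 1 by omega, pow_succ]
        refine le_of_eq ?_
        field_simp
      · positivity
  refine (Finset.sum_le_sum fun w _ => hterm w).trans ?_
  rw [Finset.sum_add_distrib, ← Finset.sum_mul, ← Finset.sum_mul]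
  have h1 : ∑ w, (if w ∈ W then (1 : ℝ) else 0) ≤ r := by
    simpa using hW
  have h2 : ∑ w, G.adjMatrix ℝ u w ≤ D := by
    refine le_trans (le_of_eq ?_) (hdeg u)
    simp [SimpleGraph.adjMatrix_apply, ← SimpleGraph.card_neighborFinset_eq_degree,
      SimpleGraph.neighborFinset_eq_filter]
  have h3 := mul_le_mul_of_nonneg_right h1 (show 0 ≤ c ^ (r - #W) * b by positivity)
  have h4 := mul_le_mul_of_nonneg_right h2 (show 0 ≤ c ^ (r - #W) * (b / c) by positivity)
  calc _ ≤ _ := add_le_add h3 h4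
    _ = _ := by field_simp

/-- The expected number of walks which survive the deletion of a random set: a walk visiting more
than `r` vertices survives with probability at most `(1 - p) ^ (r + 1)`, and the walks visiting at
most `r` vertices are counted step by step. -/
theorem sum_bernoulliWeight_mul_walks_le {p : ℝ} (h0 : 0 ≤ p) (h1 : p ≤ 1) {D c : ℝ}
    (hdeg : ∀ u, (G.degree u : ℝ) ≤ D) (hD : 0 ≤ D) (hc : 1 ≤ c) (r t : ℕ)
    (W : Finset V) {u : V} (hu : u ∈ W) (v : V) :
    ∑ Q : Finset V, (if Disjoint W Q then
        bernoulliWeight p Q * ((isolate G Q).adjMatrix ℝ ^ t) u v else 0)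
      ≤ (1 - p) ^ (r + 1) * (G.adjMatrix ℝ ^ t) u v
        + (if #W ≤ r then c ^ (r - #W) * (r + D / c) ^ t else 0) := by
  have hp : 0 ≤ 1 - p := by linarith
  have hc0 : 0 < c := by linarith
  induction t generalizing W u with
  | zero =>
    simp only [pow_zero, mul_one]
    by_cases huv : u = v
    · simp only [one_apply, huv, if_true, mul_one, sum_bernoulliWeight_disjoint]
      split_ifs with hW
      · have ha : (1 - p) ^ #W ≤ 1 := pow_le_one₀ hp (by linarith)
        have hb := one_le_pow₀ hc (n := r - #W)
        have := pow_nonneg hp (r + 1)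
        linarith
      · rw [add_zero]
        exact pow_le_pow_of_le_one hp (by linarith) (by omega)
    · simp only [one_apply, huv, if_false, mul_zero, ite_self, Finset.sum_const_zero, zero_add]
      split_ifs <;> positivity
  | succ t ih =>
    -- First-step decomposition. The start `u` lies in `W`, so it survives; the next vertex `w`
    -- joins the visited set that `Q` must avoid.
    have hstep : ∀ Q : Finset V, (if Disjoint W Q then
          bernoulliWeight p Q * ((isolate G Q).adjMatrix ℝ ^ (t + 1)) u v else 0)
        = ∑ w, G.adjMatrix ℝ u w * (if Disjoint (insert w W) Q then
          bernoulliWeight p Q * ((isolate G Q).adjMatrix ℝ ^ t) w v else 0) := by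
      intro Q
      split_ifs with hW
      · rw [pow_succ', mul_apply, Finset.mul_sum]
        refine Finset.sum_congr rfl fun w _ => ?_
        have huQ : u ∉ Q := Finset.disjoint_left.1 hW hu
        simp only [adjMatrix_isolate_apply, Finset.disjoint_insert_left]
        by_cases hw : w ∈ Q
        · simp [hw]
        · simp only [huQ, hw, not_false_eq_true, and_self, if_true, hW]
          ring
      · refine (Finset.sum_eq_zero fun w _ => ?_).symm
        simp [Finset.disjoint_insert_left, hW]
    simp only [hstep]
    rw [Finset.sum_comm]
    simp only [← Finset.mul_sum]
    calc _ ≤ ∑ w, G.adjMatrix ℝ u w * ((1 - p) ^ (r + 1) * (G.adjMatrix ℝ ^ t) w v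
            + (if #(insert w W) ≤ r then c ^ (r - #(insert w W)) * (r + D / c) ^ t else 0)) :=
          Finset.sum_le_sum fun w _ => mul_le_mul_of_nonneg_left
            (ih (insert w W) (Finset.mem_insert_self w W)) (adjMatrix_nonneg u w)
      _ = (1 - p) ^ (r + 1) * (G.adjMatrix ℝ ^ (t + 1)) u v
          + ∑ w, G.adjMatrix ℝ u w *
            (if #(insert w W) ≤ r then c ^ (r - #(insert w W)) * (r + D / c) ^ t else 0) := by
          rw [pow_succ' (G.adjMatrix ℝ), mul_apply, Finset.mul_sum, ← Finset.sum_add_distrib]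
          refine Finset.sum_congr rfl fun w _ => ?_
          ring
      _ ≤ _ := by
          refine add_le_add le_rfl ?_
          have := sum_adjMatrix_insert_le G hdeg hc0
            (show 0 ≤ ((r : ℝ) + D / c) ^ t by positivity) (r := r) W u
          rw [pow_succ' ((r : ℝ) + D / c)]
          exact this

variable {G}

/-- A star with `d` leaves already has top eigenvalue `√d`; the test vector is `lam` at the centre
and 1 on the neighbours, and edges among neighbours only help. -/
theorem FormLE.degree_le {lam : ℝ} {k : ℕ} (hk : 1 ≤ k) {v : V}
    (h : FormLE (G.adjMatrix ℝ) (closedBall G k v) lam) (hlam : 0 < lam) :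
    (G.degree v : ℝ) ≤ lam ^ 2 := by
  set y : V → ℝ := fun u => if G.Adj v u then 1 else 0 with hy
  have h1 := h (lam • Pi.single v 1 + (1 : ℝ) • y) fun u hu => by
    have hu' : u ∉ closedBall G 1 v := fun h => hu (closedBall_mono hk v h)
    rw [mem_closedBall_one, not_or] at hu'
    simp [hy, hu'.1, hu'.2]
  have hd : ∑ u, (if G.Adj v u then (1 : ℝ) else 0) = G.degree v := by
    simp [← SimpleGraph.card_neighborFinset_eq_degree, SimpleGraph.neighborFinset_eq_filter]
  have e1 : Pi.single v 1 ⬝ᵥ G.adjMatrix ℝ *ᵥ Pi.single v 1 = 0 := by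
    rw [single_one_dotProduct, mulVec_single_one]; simp
  have e2 : Pi.single v 1 ⬝ᵥ G.adjMatrix ℝ *ᵥ y = G.degree v := by
    rw [single_one_dotProduct, ← hd]
    simp only [mulVec, dotProduct, hy, SimpleGraph.adjMatrix_apply]
    exact Finset.sum_congr rfl fun u _ => by split_ifs <;> norm_num
  have e3 : 0 ≤ y ⬝ᵥ G.adjMatrix ℝ *ᵥ y := by
    have hy0 : ∀ u, 0 ≤ y u := fun u => by simp only [hy]; split_ifs <;> norm_num
    rw [dotProduct_mulVec_eq_sum]
    exact Finset.sum_nonneg fun u _ => Finset.sum_nonneg fun w _ =>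
      mul_nonneg (mul_nonneg (hy0 u) (adjMatrix_nonneg u w)) (hy0 w)
  have e4 : y ⬝ᵥ y = G.degree v := by
    rw [← hd]
    exact Finset.sum_congr rfl fun u _ => by simp only [hy]; split_ifs <;> norm_num
  have e5 : Pi.single v (1 : ℝ) ⬝ᵥ y = 0 := by
    rw [single_one_dotProduct]; simp [hy]
  have e6 : Pi.single v (1 : ℝ) ⬝ᵥ Pi.single v 1 = 1 := by simp
  rw [dotProduct_mulVec_add_smul (G.isHermitian_adjMatrix ℝ), dotProduct_self_add_smul, e1, e2,
    e4, e5, e6] at h1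
  have h2 : lam * G.degree v ≤ lam * lam ^ 2 := by nlinarith
  exact le_of_mul_le_mul_left h2 hlam

/-- The multiplicity bound from deleting a random set of vertices of density `p`. -/
theorem eigMultiplicity_le_of_random_deletion {lam : ℝ} (hlam : 0 < lam) {k : ℕ} (hk : 1 ≤ k)
    (h : ∀ v, FormLE (G.adjMatrix ℝ) (closedBall G k v) lam) {p : ℝ} (h0 : 0 ≤ p) (h1 : p ≤ 1)
    {r : ℕ} (hr : 1 ≤ r) {c : ℝ} (hc : 1 ≤ c) :
    (eigMultiplicity G lam : ℝ) ≤ Fintype.card V *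
      (p + (1 - p) ^ (r + 1) + c ^ (r - 1) * ((r + lam ^ 2 / c) / lam) ^ (2 * k)) := by
  have hL : 0 < lam ^ (2 * k) := by positivity
  -- No closed walk of positive length starts at a deleted vertex, so the count may start with
  -- visited set `{v}`.
  have hdiag : ∀ (Q : Finset V) (v : V), ((isolate G Q).adjMatrix ℝ ^ (2 * k)) v v
      = if Disjoint {v} Q then ((isolate G Q).adjMatrix ℝ ^ (2 * k)) v v else 0 := by
    intro Q v
    split_ifs with hd
    · rfl
    · exact adjMatrix_isolate_pow_diag_of_mem (by omega) (by simpa using hd)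
  have hQ : ∀ Q : Finset V, (eigMultiplicity G lam : ℝ) * lam ^ (2 * k)
      ≤ #Q * lam ^ (2 * k) + ∑ v, ((isolate G Q).adjMatrix ℝ ^ (2 * k)) v v := by
    intro Q
    have ha : (eigMultiplicity G lam : ℝ) ≤ #Q + eigMultiplicity (isolate G Q) lam := by
      exact_mod_cast eigMultiplicity_le_add_isolate (G := G) (Q := Q) fun f _ hf => hf
    have hb := finrank_eigenspace_mul_pow_le_trace ((isolate G Q).isHermitian_adjMatrix ℝ) lam k
    calc _ ≤ (#Q + (eigMultiplicity (isolate G Q) lam : ℝ)) * lam ^ (2 * k) :=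
          mul_le_mul_of_nonneg_right ha hL.le
      _ ≤ _ := by rw [add_mul]; exact add_le_add le_rfl hb
  have havg : (eigMultiplicity G lam : ℝ) * lam ^ (2 * k)
      ≤ Fintype.card V * p * lam ^ (2 * k) + ∑ v, ∑ Q : Finset V, (if Disjoint {v} Q then
        bernoulliWeight p Q * ((isolate G Q).adjMatrix ℝ ^ (2 * k)) v v else 0) := by
    calc _ = ∑ Q : Finset V, bernoulliWeight p Q * ((eigMultiplicity G lam : ℝ) * lam ^ (2 * k)) :=
          by rw [← Finset.sum_mul, sum_bernoulliWeight, one_mul]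
      _ ≤ ∑ Q : Finset V, bernoulliWeight p Q *
          (#Q * lam ^ (2 * k) + ∑ v, ((isolate G Q).adjMatrix ℝ ^ (2 * k)) v v) :=
          Finset.sum_le_sum fun Q _ =>
            mul_le_mul_of_nonneg_left (hQ Q) (bernoulliWeight_nonneg h0 h1 Q)
      _ = _ := by
          rw [← sum_bernoulliWeight_mul_card, Finset.sum_mul, Finset.sum_comm,
            ← Finset.sum_add_distrib]
          refine Finset.sum_congr rfl fun Q _ => ?_
          rw [mul_add, mul_assoc, Finset.mul_sum]
          refine congrArg₂ _ rfl (Finset.sum_congr rfl fun v _ => ?_)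
          rw [hdiag Q v]
          split_ifs <;> simp
  have hv : ∀ v, ∑ Q : Finset V, (if Disjoint {v} Q then
        bernoulliWeight p Q * ((isolate G Q).adjMatrix ℝ ^ (2 * k)) v v else 0)
      ≤ (1 - p) ^ (r + 1) * lam ^ (2 * k) + c ^ (r - 1) * (r + lam ^ 2 / c) ^ (2 * k) := by
    intro v
    refine (sum_bernoulliWeight_mul_walks_le G h0 h1 (fun u => (h u).degree_le hk hlam)
      (sq_nonneg lam) hc r (2 * k) {v} (Finset.mem_singleton_self v) v).trans ?_
    rw [Finset.card_singleton, if_pos hr]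
    refine add_le_add (mul_le_mul_of_nonneg_left ((h v).adjMatrix_pow_diag_le hlam)
      (pow_nonneg (by linarith) _)) le_rfl
  have hfin := havg.trans (add_le_add le_rfl (Finset.sum_le_sum fun v _ => hv v))
  rw [Finset.sum_const, Finset.card_univ, nsmul_eq_mul] at hfin
  refine le_of_mul_le_mul_right (hfin.trans (le_of_eq ?_)) hL
  rw [div_pow]
  field_simp
  ring

end RandomDeletion


/-! ### Numerical estimates with logarithms -/

section LogEstimates

/-- Concavity: the graph lies above its chord on `[0, s]`. It is Bernoulli's inequality with
exponent `x / s ≤ 1`. -/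
theorem chord_le_logb {x s : ℝ} (hx : 0 ≤ x) (hs : 0 < s) (hxs : x ≤ s) :
    x / s * Real.logb 2 (1 + s) ≤ Real.logb 2 (1 + x) := by
  have h := rpow_one_add_le_one_add_mul_self (s := s) (by linarith) (p := x / s)
    (div_nonneg hx hs.le)
    ((div_le_one hs).2 hxs)
  rw [div_mul_cancel₀ _ hs.ne'] at h
  rw [← Real.logb_rpow_eq_mul_logb_of_pos (by linarith)]
  exact Real.logb_le_logb_of_le (by norm_num) (by positivity) h

theorem le_logb_two_of_pow_le {x : ℝ} {a b : ℕ} (hb : 0 < b)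
    (h : (2 : ℝ) ^ a ≤ x ^ b) : (a : ℝ) / b ≤ Real.logb 2 x := by
  have h1 := Real.logb_le_logb_of_le (b := 2) (by norm_num) (by positivity) h
  rw [Real.logb_pow, Real.logb_pow, Real.logb_self_eq_one (by norm_num), mul_one] at h1
  rw [div_le_iff₀ (by exact_mod_cast hb)]
  linarith

theorem nat_le_logb_two {x : ℝ} {a : ℕ} (h : (2 : ℝ) ^ a ≤ x) : (a : ℝ) ≤ Real.logb 2 x := by
  simpa using le_logb_two_of_pow_le (b := 1) one_pos (by simpa)

/-- The chord to `15 = 2⁴ - 1` gives the ratio `4/15`. In this range the first bound of the theorem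
exceeds `n` and is trivial. -/
theorem one_fifth_le_logRatio {x : ℝ} (h0 : 0 ≤ x) (h1 : x ≤ 15) : 1 / 5 ≤ logRatio x := by
  unfold logRatio
  split_ifs with h
  · have : ((1 : ℕ) : ℝ) ≤ Real.logb 2 (Real.exp 1) :=
      nat_le_logb_two (by have := Real.add_one_le_exp 1; norm_num at this ⊢; linarith)
    norm_num at this ⊢
    linarith
  · have hx : 0 < x := lt_of_le_of_ne h0 (Ne.symm h)
    have h2 := chord_le_logb h0 (show (0 : ℝ) < 15 by norm_num) h1
    have h3 := nat_le_logb_two (x := 1 + 15) (a := 4) (by norm_num)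
    rw [le_div_iff₀ hx, add_comm x 1]
    push_cast at h3
    have h4 := mul_le_mul_of_nonneg_left h3 (show 0 ≤ x / 15 by positivity)
    linarith

/-- The other trivial range of the first bound; `1/9` comes from `Δ ≤ n⁹`. Chords serve up to `L =
1`, powers of two beyond. The margin is thin at the left end: there the chord gives about `1.82 L²`,
which reaches `L/5` only from `L ≈ 0.11` on. -/
theorem one_fifth_le_logSq {L : ℝ} (h0 : 1 / 9 ≤ L) (h1 : L ≤ 127) :
    1 / 5 ≤ Real.logb 2 (1 + L) ^ 2 / L := by
  have hL : 0 < L := by linarith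
  rw [le_div_iff₀ hL]
  have hbig : ∀ a : ℕ, (2 : ℝ) ^ a ≤ 1 + L → (a : ℝ) ^ 2 ≤ Real.logb 2 (1 + L) ^ 2 :=
    fun a ha => pow_le_pow_left₀ (by positivity) (nat_le_logb_two ha) 2
  have hsmall : ∀ s c : ℝ, 0 < s → L ≤ s → 0 ≤ c → c ≤ Real.logb 2 (1 + s) →
      (L / s * c) ^ 2 ≤ Real.logb 2 (1 + L) ^ 2 := by
    intro s c hs hLs hc hcs
    refine pow_le_pow_left₀ (by positivity) (le_trans ?_ (chord_le_logb hL.le hs hLs)) 2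
    exact mul_le_mul_of_nonneg_left hcs (by positivity)
  rcases le_total L (1 / 8) with h | h
  -- `13/77` is a rational lower approximation of `log₂ (9/8)`.
  · have h2 := le_logb_two_of_pow_le (x := 1 + 1 / 8) (a := 13) (b := 77)
      (by norm_num) (by norm_num)
    have h3 := hsmall (1 / 8) _ (by norm_num) h (by positivity) h2
    norm_num at h3
    nlinarith
  rcases le_total L (1 / 5) with h | h
  · have h2 := le_logb_two_of_pow_le (x := 1 + 1 / 5) (a := 6) (b := 23)
      (by norm_num) (by norm_num)
    have h3 := hsmall (1 / 5) _ (by norm_num) h (by positivity) h2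
    norm_num at h3
    nlinarith
  rcases le_total L 1 with h | h
  · have h2 := nat_le_logb_two (x := 1 + 1) (a := 1) (by norm_num)
    have h3 := hsmall 1 _ (by norm_num) h (by positivity) h2
    norm_num at h3
    nlinarith
  rcases le_total L 3 with h | h
  · have h3 := hbig 1 (by linarith)
    rw [Nat.cast_one, one_pow] at h3
    linarith
  rcases le_total L 15 with h | h
  · have h3 := hbig 2 (by linarith)
    norm_num at h3
    nlinarith
  rcases le_total L 63 with h | h
  · have h3 := hbig 4 (by linarith)
    norm_num at h3
    nlinarith
  · have h3 := hbig 6 (by linarith)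
    norm_num at h3
    nlinarith

/-- The exponent is what remains of `L/4 - 2(k - 2r)` when `k ≥ L/4 - 1` and `r ≤ L/28`. -/
theorem two_rpow_le_inv {L : ℝ} (hL : 127 ≤ L) : (2 : ℝ) ^ (2 - 3 * L / 28) ≤ 1 / L := by
  have h1 : (2 : ℝ) ^ (2 - 3 * L / 28) ≤ 2 ^ (2 - L / 10) :=
    Real.rpow_le_rpow_of_exponent_le (by norm_num) (by linarith)
  refine h1.trans ?_
  have h2 : (2 : ℝ) ^ (2 - L / 10) = 2 ^ (-10 : ℝ) / 2 ^ (L / 10 - 12) := by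
    rw [← Real.rpow_sub (by norm_num)]; congr 1; ring
  have h3 : 1 + (L / 10 - 12) / 2 ≤ (2 : ℝ) ^ (L / 10 - 12) := by
    rw [Real.rpow_def_of_pos (by norm_num)]
    refine le_trans ?_ (Real.add_one_le_exp _)
    have := Real.log_two_gt_d9
    nlinarith
  have h4 : (2 : ℝ) ^ (-10 : ℝ) = 1 / 1024 := by
    rw [Real.rpow_neg (by norm_num)]; norm_num
  rw [h2, h4, div_le_div_iff₀ (by positivity) (by linarith)]
  linarith

theorem exp_neg_logb_le {x y : ℝ} (hx : 0 < x) (hy : Real.logb 2 (1 + x) ≤ y) :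
    Real.exp (-y) ≤ 1 / x := by
  have h1 : Real.log (1 + x) ≤ Real.logb 2 (1 + x) := by
    rw [Real.logb, le_div_iff₀ (Real.log_pos (by norm_num))]
    have h2 := Real.log_two_lt_d9
    have h3 : 0 ≤ Real.log (1 + x) := Real.log_nonneg (by linarith)
    nlinarith
  calc Real.exp (-y) ≤ Real.exp (-Real.log (1 + x)) := Real.exp_le_exp.2 (by linarith)
    _ = (1 + x)⁻¹ := by rw [Real.exp_neg, Real.exp_log (by linarith)]
    _ ≤ 1 / x := by rw [← one_div]; exact one_div_le_one_div_of_le hx (by linarith)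

/-- The contribution of the walks with small support. -/
theorem small_support_le {lam L : ℝ} {r k : ℕ} (hr : 1 ≤ r) (hL : 127 ≤ L)
    (hrlam : 4 * (r : ℝ) ≤ lam) (hrL : r * (4 * Real.logb 2 (1 + L)) ≤ L)
    (hk : L / 4 - 1 ≤ k) :
    (lam ^ 2 / r) ^ (r - 1) * ((r + lam ^ 2 / (lam ^ 2 / r)) / lam) ^ (2 * k) ≤ 1 / L := by
  have hr1 : (1 : ℝ) ≤ r := by exact_mod_cast hr
  have hr0 : (0 : ℝ) < r := by linarith
  have hlam : 0 < lam := by linarith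
  have hl7 : (7 : ℝ) ≤ Real.logb 2 (1 + L) := by
    exact_mod_cast nat_le_logb_two (x := 1 + L) (a := 7) (by norm_num; linarith)
  have hr28 : 28 * (r : ℝ) ≤ L := by nlinarith
  -- The choice `c = lam²/r` balances the two kinds of step: `r + lam²/c = 2r`, so each contributes
  -- `2/b` after division by `lam`. As `b ≥ 4`, two steps contribute at most `1/b`.
  obtain ⟨b, hb⟩ : ∃ b, b = lam / r := ⟨_, rfl⟩
  have hb4 : 4 ≤ b := by rw [hb, le_div_iff₀ hr0]; exact hrlam
  have hlb : lam = b * r := by rw [hb]; field_simp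
  have h2r : 2 * r ≤ k := by
    have : (2 * r : ℝ) ≤ k := by linarith
    exact_mod_cast this
  have e1 : lam ^ 2 / r = b ^ 2 * r := by rw [hlb]; field_simp
  have e2 : (r + lam ^ 2 / (lam ^ 2 / r)) / lam = 2 / b := by
    rw [hlb]; field_simp; norm_num
  rw [e2, e1]
  have s1 : (b ^ 2 * r) ^ (r - 1) ≤ (b ^ 2 * r) ^ r :=
    pow_le_pow_right₀ (by nlinarith) (Nat.sub_le _ _)
  have s2 : (2 / b) ^ (2 * k) ≤ (1 / b) ^ k := by
    rw [pow_mul]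
    refine pow_le_pow_left₀ (by positivity) ?_ k
    rw [div_pow, div_le_div_iff₀ (by positivity) (by positivity)]
    nlinarith
  have s3 : (b ^ 2 * r) ^ r * (1 / b) ^ k = (r : ℝ) ^ r * (1 / b) ^ (k - 2 * r) := by
    obtain ⟨j, rfl⟩ := Nat.exists_eq_add_of_le h2r
    have h1 : b ^ (2 * r) * (1 / b) ^ (2 * r) = 1 := by
      rw [← mul_pow, mul_one_div_cancel (by linarith), one_pow]
    rw [Nat.add_sub_cancel_left, pow_add, mul_pow, ← pow_mul]
    linear_combination (r : ℝ) ^ r * (1 / b) ^ j * h1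
  have s4 : (1 / b) ^ (k - 2 * r) ≤ (1 / 4) ^ (k - 2 * r) :=
    pow_le_pow_left₀ (by positivity) (one_div_le_one_div_of_le (by norm_num) hb4) _
  have s5 : (r : ℝ) ^ r ≤ 2 ^ (L / 4) := by
    calc (r : ℝ) ^ r ≤ (1 + L) ^ r := pow_le_pow_left₀ hr0.le (by linarith) r
      _ = 2 ^ (Real.logb 2 (1 + L) * r) := by
        rw [Real.rpow_mul (by norm_num), Real.rpow_logb (by norm_num) (by norm_num) (by linarith),
          Real.rpow_natCast]
      _ ≤ 2 ^ (L / 4) := Real.rpow_le_rpow_of_exponent_le (by norm_num) (by linarith)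
  have s6 : ((1 : ℝ) / 4) ^ (k - 2 * r) = 2 ^ (-(2 * ((k : ℝ) - 2 * r))) := by
    rw [Real.rpow_neg (by norm_num), Real.rpow_mul (by norm_num), one_div, inv_pow]
    congr 1
    rw [← Real.rpow_natCast]
    push_cast [h2r]
    norm_num
  calc (b ^ 2 * r) ^ (r - 1) * (2 / b) ^ (2 * k) ≤ (b ^ 2 * r) ^ r * (1 / b) ^ k := by gcongr
    _ ≤ (r : ℝ) ^ r * (1 / 4) ^ (k - 2 * r) := by rw [s3]; gcongr
    _ ≤ 2 ^ (L / 4) * 2 ^ (-(2 * ((k : ℝ) - 2 * r))) := by rw [s6]; gcongr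
    _ = 2 ^ (L / 4 + -(2 * ((k : ℝ) - 2 * r))) := by rw [Real.rpow_add (by norm_num)]
    _ ≤ 2 ^ (2 - 3 * L / 28) :=
        Real.rpow_le_rpow_of_exponent_le (by norm_num) (by linarith)
    _ ≤ 1 / L := two_rpow_le_inv hL

end LogEstimates

/-! ### First bound: choice of parameters -/

section FirstBound

variable {V : Type*} [Fintype V] [DecidableEq V] (G : SimpleGraph V) [DecidableRel G.Adj]

theorem card_le_maxDegree_add_one_of_lambda2_neg (hn : 2 ≤ Fintype.card V)
    (h : lambda2 G hn < 0) : Fintype.card V ≤ G.maxDegree + 1 := by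
  obtain ⟨v⟩ : Nonempty V := Fintype.card_pos_iff.1 (by omega)
  have hadj : ∀ u, u ≠ v → G.Adj v u := by
    intro u huv
    by_contra hadj
    exact absurd (lambda2_nonneg_of_not_adj G hn huv.symm hadj) (not_le.2 h)
  have h1 : G.neighborFinset v = Finset.univ.erase v := by
    ext u
    simp only [SimpleGraph.mem_neighborFinset, mem_erase, mem_univ, and_true]
    exact ⟨fun h => h.ne', hadj u⟩
  have h2 := G.degree_le_maxDegree v
  rw [← SimpleGraph.card_neighborFinset_eq_degree, h1, Finset.card_erase_of_mem (mem_univ v),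
    Finset.card_univ] at h2
  omega

/-- The multiplicity bound for `λ₂` large and `log_Δ n` large. -/
theorem eigMultiplicity_le_of_large (hn : 2 ≤ Fintype.card V) {Δ : ℝ} (hΔ : 2 ≤ Δ)
    (hdeg : (G.maxDegree : ℝ) ≤ Δ) {L q : ℝ} (hcard : (Fintype.card V : ℝ) = Δ ^ L)
    (hL : 127 ≤ L) (hlam : 15 ≤ lambda2 G hn)
    (hq1 : Real.logb 2 (lambda2 G hn + 1) / lambda2 G hn ≤ q)
    (hq2 : Real.logb 2 (1 + L) ^ 2 / L ≤ q) (hq5 : 5 * q ≤ 1) :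
    (eigMultiplicity G (lambda2 G hn) : ℝ) ≤ 5 * Fintype.card V * q := by
  set lam := lambda2 G hn with hlamdef
  have hlam0 : 0 < lam := by linarith
  have hL0 : 0 < L := by linarith
  have hl4 : (4 : ℝ) ≤ Real.logb 2 (lam + 1) := by
    exact_mod_cast nat_le_logb_two (x := lam + 1) (a := 4) (by norm_num; linarith)
  have hl7 : (7 : ℝ) ≤ Real.logb 2 (1 + L) := by
    exact_mod_cast nat_le_logb_two (x := 1 + L) (a := 7) (by norm_num; linarith)
  rw [div_le_iff₀ hlam0] at hq1
  rw [div_le_iff₀ hL0] at hq2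
  have hqlam : 1 / lam ≤ q / 4 := by
    rw [div_le_div_iff₀ hlam0 (by norm_num)]; linarith
  have hqL : 1 / L ≤ q / 4 := by
    rw [div_le_div_iff₀ hL0 (by norm_num)]; nlinarith
  set ℓ := Real.logb 2 (1 + L) with hℓ
  have hℓL : 35 * ℓ ≤ L := by nlinarith
  -- `M` is the cutoff for the number of distinct vertices: `r ≤ lam/4` makes each step of a
  -- short-support walk a loss, and `r ℓ ≤ L/4` keeps the factor `r^r` below `2^(L/4)`.
  set M := min (lam / 4) (L / (4 * ℓ)) with hM
  have hM1 : 1 ≤ M := le_min (by linarith) (by rw [le_div_iff₀ (by linarith)]; linarith)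
  set r := ⌊M⌋₊ with hr
  have hr1 : 1 ≤ r := Nat.one_le_floor_iff _ |>.2 hM1
  have hrM : (r : ℝ) ≤ M := Nat.floor_le (by linarith)
  have hrlam : 4 * (r : ℝ) ≤ lam := by
    have := hrM.trans (min_le_left _ _); linarith
  have hrL : r * (4 * ℓ) ≤ L := by
    have := hrM.trans (min_le_right _ _)
    rwa [le_div_iff₀ (by linarith)] at this
  -- The exceptional set then has at most `Δ^(L/2 + 2)` vertices, about `√n`.
  set k := ⌊L / 4⌋₊ with hk
  have hk1 : 1 ≤ k := Nat.one_le_floor_iff _ |>.2 (by linarith)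
  have hkle : (k : ℝ) ≤ L / 4 := Nat.floor_le (by linarith)
  have hkge : L / 4 - 1 ≤ k := (Nat.sub_one_lt_floor _).le
  obtain ⟨U, hU, hmU, hloc⟩ := exists_isolate_locally_bounded G hn hΔ hdeg hlam0.le k
  have hr0 : (1 : ℝ) ≤ r := by exact_mod_cast hr1
  have hq0 : 0 < q := by
    have : 0 < 1 / L := by positivity
    linarith
  -- Density `4q` out of a budget of `5q`; long walks, short-support walks and the exceptional set
  -- take at most `q/4` each.
  have hm := eigMultiplicity_le_of_random_deletion hlam0 hk1 hloc (p := 4 * q)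
    (by linarith) (by linarith) hr1 (c := lam ^ 2 / r)
    (by rw [le_div_iff₀ (by linarith)]; nlinarith)
  have hsmall := small_support_le hr1 hL hrlam hrL hkge
  have hlong : (1 - 4 * q) ^ (r + 1) ≤ q / 4 := by
    have h1 : (1 - 4 * q) ^ (r + 1) ≤ Real.exp (-(4 * q * M)) := by
      calc (1 - 4 * q) ^ (r + 1) ≤ Real.exp (-(4 * q)) ^ (r + 1) :=
            pow_le_pow_left₀ (by linarith) (Real.one_sub_le_exp_neg _) _
        _ = Real.exp (-(4 * q * (r + 1))) := by
            rw [← Real.exp_nat_mul]; push_cast; ring_nf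
        _ ≤ _ := by
            refine Real.exp_le_exp.2 (neg_le_neg ?_)
            exact mul_le_mul_of_nonneg_left (Nat.lt_floor_add_one M).le (by linarith)
    refine h1.trans ?_
    -- Whichever term is the minimum, `4qM` is at least `log₂ (lam + 1)` or at least `ℓ = log₂ (1 +
    -- L)`; these are the two entries of the maximum.
    rcases le_total (lam / 4) (L / (4 * ℓ)) with hcase | hcase
    · rw [hM, min_eq_left hcase]
      refine (exp_neg_logb_le hlam0 ?_).trans hqlam
      rw [add_comm]
      linarith
    · rw [hM, min_eq_right hcase]
      refine (exp_neg_logb_le hL0 ?_).trans hqL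
      rw [← hℓ, mul_div_assoc', le_div_iff₀ (by linarith)]
      nlinarith
  have hUn : (#U : ℝ) ≤ Fintype.card V * (q / 4) := by
    refine hU.trans ?_
    rw [hcard]
    have h1 : Δ ^ (2 * k + 2) ≤ Δ ^ L * Δ ^ (2 - 3 * L / 28) := by
      rw [← Real.rpow_add (by linarith), ← Real.rpow_natCast]
      refine Real.rpow_le_rpow_of_exponent_le (by linarith) ?_
      push_cast
      linarith
    refine h1.trans (mul_le_mul_of_nonneg_left ?_ (Real.rpow_nonneg (by linarith) _))
    refine le_trans ?_ ((two_rpow_le_inv hL).trans hqL)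
    exact Real.rpow_le_rpow_of_nonpos (by norm_num) hΔ (by linarith)
  have hmU' : (eigMultiplicity G lam : ℝ) ≤ #U + eigMultiplicity (isolate G U) lam := by
    exact_mod_cast hmU
  have hn0 : (0 : ℝ) ≤ Fintype.card V := Nat.cast_nonneg _
  have hfin : (Fintype.card V : ℝ) * (4 * q + (1 - 4 * q) ^ (r + 1) +
      (lam ^ 2 / r) ^ (r - 1) * ((r + lam ^ 2 / (lam ^ 2 / r)) / lam) ^ (2 * k))
      ≤ Fintype.card V * (4 * q + q / 4 + q / 4) :=
    mul_le_mul_of_nonneg_left (by linarith) hn0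
  nlinarith [mul_nonneg hn0 hq0.le]

theorem eigMultiplicity_lambda2_le_mul_max (hn : 2 ≤ Fintype.card V) {Δ : ℝ} (hΔ : 2 ≤ Δ)
    (hdeg : (G.maxDegree : ℝ) ≤ Δ) (hΔn : Δ ≤ (Fintype.card V : ℝ) ^ 9) :
    (eigMultiplicity G (lambda2 G hn) : ℝ) ≤ 5 * (Fintype.card V : ℝ) *
      max (logRatio (lambda2 G hn)) (Real.logb 2 (1 + Real.logb Δ (Fintype.card V : ℝ)) ^ 2 /
        Real.logb Δ (Fintype.card V : ℝ)) := by
  set n := (Fintype.card V : ℝ) with hndef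
  have hn2 : (2 : ℝ) ≤ n := by rw [hndef]; exact_mod_cast hn
  set L := Real.logb Δ n with hLdef
  set q := max (logRatio (lambda2 G hn)) (Real.logb 2 (1 + L) ^ 2 / L) with hq
  have hcard : n = Δ ^ L := (Real.rpow_logb (by linarith) (by linarith) (by linarith)).symm
  have htriv : (1 / 5 ≤ q) → (eigMultiplicity G (lambda2 G hn) : ℝ) ≤ 5 * n * q := by
    intro h
    have : (eigMultiplicity G (lambda2 G hn) : ℝ) ≤ n := by
      rw [hndef]
      exact_mod_cast eigMultiplicity_le_card G _
    nlinarith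
  have hL9 : 1 / 9 ≤ L := by
    have h1 := Real.logb_le_logb_of_le (b := Δ) (by linarith) (by linarith) hΔn
    rw [Real.logb_self_eq_one (by linarith), Real.logb_pow] at h1
    push_cast at h1
    linarith
  rcases le_total L 127 with hL | hL
  · exact htriv ((one_fifth_le_logSq hL9 hL).trans (le_max_right _ _))
  rcases lt_or_ge (lambda2 G hn) 0 with hneg | hnn
  -- Negative λ₂ forces a complete graph, so `n ≤ Δ + 1 ≤ Δ²` and `L ≤ 2`.
  · exfalso
    have h1 := card_le_maxDegree_add_one_of_lambda2_neg G hn hneg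
    have h2 : n ≤ G.maxDegree + 1 := by rw [hndef]; exact_mod_cast h1
    have h3 : n ≤ Δ ^ 2 := by nlinarith
    have h4 := Real.logb_le_logb_of_le (b := Δ) (by linarith) (by linarith) h3
    rw [Real.logb_pow, Real.logb_self_eq_one (by linarith)] at h4
    push_cast at h4
    linarith
  rcases le_total (lambda2 G hn) 15 with hlam | hlam
  · exact htriv ((one_fifth_le_logRatio hnn hlam).trans (le_max_left _ _))
  rcases le_total (1 / 5) q with h5 | h5
  · exact htriv h5
  refine eigMultiplicity_le_of_large G hn hΔ hdeg hcard hL hlam ?_ (le_max_right _ _) (by linarith)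
  refine le_trans (le_of_eq ?_) (le_max_left _ _)
  rw [logRatio, if_neg (by linarith)]

end FirstBound


/-! ### A gap from leaking Perron mass -/

section SpectralGap

variable {V : Type*} [Fintype V] [DecidableEq V] {G : SimpleGraph V} [DecidableRel G.Adj]

theorem sum_adjMatrix_eq_degree (u : V) : ∑ w, G.adjMatrix ℝ u w = G.degree u := by
  simp [SimpleGraph.adjMatrix_apply, ← SimpleGraph.card_neighborFinset_eq_degree,
    SimpleGraph.neighborFinset_eq_filter]

theorem adjMatrix_comm (u w : V) : G.adjMatrix ℝ u w = G.adjMatrix ℝ w u := by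
  simp [SimpleGraph.adjMatrix_apply, G.adj_comm]

/-- Apply `2 x_u x_w ≤ x_u² + x_w²` along every edge. -/
theorem formLE_of_degree_le {s : Finset V} {d : ℝ} (h : ∀ u ∈ s, (G.degree u : ℝ) ≤ d) :
    FormLE (G.adjMatrix ℝ) s d := by
  intro x hx
  have h1 : x ⬝ᵥ G.adjMatrix ℝ *ᵥ x ≤ ∑ u, (G.degree u : ℝ) * (x u * x u) := by
    have e1 : ∑ u, ∑ w, G.adjMatrix ℝ u w * (x u * x u) = ∑ u, (G.degree u : ℝ) * (x u * x u) :=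
      Finset.sum_congr rfl fun u _ => by rw [← Finset.sum_mul, sum_adjMatrix_eq_degree]
    have e2 : ∑ u, ∑ w, G.adjMatrix ℝ u w * (x w * x w)
        = ∑ u, (G.degree u : ℝ) * (x u * x u) := by
      rw [Finset.sum_comm, ← e1]
      exact Finset.sum_congr rfl fun u _ => Finset.sum_congr rfl fun w _ => by
        rw [adjMatrix_comm]
    have e3 : 2 * (x ⬝ᵥ G.adjMatrix ℝ *ᵥ x) ≤ ∑ u, ∑ w, G.adjMatrix ℝ u w * (x u * x u)
        + ∑ u, ∑ w, G.adjMatrix ℝ u w * (x w * x w) := by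
      rw [dotProduct_mulVec_eq_sum, Finset.mul_sum, ← Finset.sum_add_distrib]
      refine Finset.sum_le_sum fun u _ => ?_
      rw [Finset.mul_sum, ← Finset.sum_add_distrib]
      refine Finset.sum_le_sum fun w _ => ?_
      nlinarith [mul_nonneg (adjMatrix_nonneg (G := G) u w) (sq_nonneg (x u - x w))]
    linarith
  refine h1.trans ?_
  rw [dotProduct, Finset.mul_sum]
  refine Finset.sum_le_sum fun u _ => ?_
  by_cases hu : u ∈ s
  · exact mul_le_mul_of_nonneg_right (h u hu) (mul_self_nonneg _)
  · simp [hx u hu]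

/-- If every vertex of large degree in `X` is at distance at most `4` from the complement of `X`,
then the quadratic form on `X` has a gap to the bound on the surrounding ball. -/
theorem formLE_sub_of_exit {lam : ℝ} (hlam : 1 ≤ lam) {k : ℕ} {v : V}
    (h : FormLE (G.adjMatrix ℝ) (closedBall G (k + 1) v) lam) {X : Finset V}
    (hX : X ⊆ closedBall G k v)
    (hexit : ∀ u ∈ X, lam - 1 / 2 < G.degree u → ∃ w, w ∉ X ∧ w ∈ closedBall G 4 u) :
    FormLE (G.adjMatrix ℝ) X (lam - 1 / (20 * lam ^ 8)) := by
  classical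
  rcases X.eq_empty_or_nonempty with h0 | hne
  · intro x hx
    have : x = 0 := funext fun u => hx u (by simp [h0])
    simp [this]
  have hA := G.isHermitian_adjMatrix ℝ
  obtain ⟨μ, x, hx0, hxs, hx1, hxμ, hform⟩ :=
    exists_perron_vector (A := G.adjMatrix ℝ) adjMatrix_nonneg hne
  refine hform.mono_right ?_
  have hper : ∀ u ∈ X, (G.adjMatrix ℝ *ᵥ x) u = μ * x u := fun u hu =>
    hform.mulVec_eq_of_eq hA hxs (by rw [hxμ, hx1, mul_one]) hu
  have hAx0 : ∀ u, 0 ≤ (G.adjMatrix ℝ *ᵥ x) u := fun u =>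
    Finset.sum_nonneg fun w _ => mul_nonneg (adjMatrix_nonneg u w) (hx0 w)
  have hμ0 : 0 ≤ μ := by
    rw [← hxμ]; exact Finset.sum_nonneg fun u _ => mul_nonneg (hx0 u) (hAx0 u)
  -- the test vector reaching out of `X`
  set s := ∑ w with w ∉ X, (G.adjMatrix ℝ *ᵥ x) w ^ 2 with hs
  have hs0 : 0 ≤ s := Finset.sum_nonneg fun _ _ => sq_nonneg _
  -- Extending `x` by `y/lam`, where `y` is `Ax` off `X`, raises the form by at least `2s/lam`,
  -- while `lam` times the squared norm rises only by `s/lam`.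
  have hgap : μ ≤ lam - s / lam := by
    set y : V → ℝ := fun w => if w ∈ X then 0 else (G.adjMatrix ℝ *ᵥ x) w with hy
    have hy0 : ∀ w, 0 ≤ y w := fun w => by
      simp only [hy]
      split_ifs
      exacts [le_rfl, hAx0 w]
    have h1 := h ((1 : ℝ) • x + (1 / lam) • y) fun u hu => by
      have hxu : u ∉ X := fun hu' => hu (closedBall_mono (Nat.le_succ k) v (hX hu'))
      have : (G.adjMatrix ℝ *ᵥ x) u = 0 :=
        mulVec_adjMatrix_eq_zero (fun w hw => hxs w fun hw' => hw (hX hw')) hu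
      simp only [hy, Pi.add_apply, Pi.smul_apply, hxs u hxu, if_neg hxu, this, smul_zero, add_zero]
    have e1 : x ⬝ᵥ y = 0 := Finset.sum_eq_zero fun u _ => by
      by_cases hu : u ∈ X
      · simp [hy, hu]
      · simp [hxs u hu]
    have e2 : y ⬝ᵥ y = s := by
      rw [hs, Finset.sum_filter]
      exact Finset.sum_congr rfl fun u _ => by by_cases hu : u ∈ X <;> simp [hy, hu, pow_two]
    have e3 : x ⬝ᵥ G.adjMatrix ℝ *ᵥ y = s := by
      rw [dotProduct_mulVec_comm hA, hs, Finset.sum_filter]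
      exact Finset.sum_congr rfl fun u _ => by by_cases hu : u ∈ X <;> simp [hy, hu, pow_two]
    have e4 : 0 ≤ y ⬝ᵥ G.adjMatrix ℝ *ᵥ y := Finset.sum_nonneg fun u _ => mul_nonneg (hy0 u)
      (Finset.sum_nonneg fun w _ => mul_nonneg (adjMatrix_nonneg u w) (hy0 w))
    rw [dotProduct_mulVec_add_smul hA, dotProduct_self_add_smul, e1, e2, e3, hxμ, hx1] at h1
    have e5 : lam * ((1 / lam) ^ 2 * s) = s / lam := by field_simp
    have e6 : 2 * 1 * (1 / lam) * s = 2 * (s / lam) := by ring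
    have e7 : 0 ≤ (1 / lam) ^ 2 * (y ⬝ᵥ G.adjMatrix ℝ *ᵥ y) := by positivity
    rw [e6] at h1
    linarith
  have hμlam : μ ≤ lam := by
    have : 0 ≤ s / lam := by positivity
    linarith
  -- the weight of the vertices close to the complement of `X`
  let C : ℕ → Finset V := fun j => {u ∈ X | ∃ w, w ∉ X ∧ w ∈ closedBall G j u}
  -- A vertex of `C (j+1)` has a neighbour outside `X` or in `C j`, and its weight is part of `Ax`
  -- there. Outside `X` the squares of `Ax` sum to `s`; on `C j` it equals `μ x`.
  have hstep : ∀ j, ∑ u ∈ C (j + 1), x u ^ 2 ≤ s + lam ^ 2 * ∑ u ∈ C j, x u ^ 2 := by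
    intro j
    have h1 : ∀ u ∈ C (j + 1), ∃ w ∈ Xᶜ ∪ C j, G.Adj u w := by
      intro u hu
      obtain ⟨huX, w, hwX, hw⟩ := Finset.mem_filter.1 hu
      rcases exists_adj_of_mem_closedBall_succ hw with rfl | ⟨w', hadj, hw'⟩
      · exact absurd huX hwX
      · refine ⟨w', ?_, hadj⟩
        by_cases hX' : w' ∈ X
        · exact Finset.mem_union_right _ (Finset.mem_filter.2 ⟨hX', w, hwX, hw'⟩)
        · exact Finset.mem_union_left _ (Finset.mem_compl.2 hX')
    have h2 : ∑ u ∈ C (j + 1), x u ^ 2 ≤ ∑ w ∈ Xᶜ ∪ C j, (G.adjMatrix ℝ *ᵥ x) w ^ 2 := by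
      calc ∑ u ∈ C (j + 1), x u ^ 2
          ≤ ∑ u ∈ C (j + 1), ∑ w ∈ Xᶜ ∪ C j, (G.adjMatrix ℝ w u * x u) ^ 2 := by
            refine Finset.sum_le_sum fun u hu => ?_
            obtain ⟨w, hw, hadj⟩ := h1 u hu
            refine le_of_eq_of_le ?_ (Finset.single_le_sum
              (f := fun w => (G.adjMatrix ℝ w u * x u) ^ 2) (fun _ _ => sq_nonneg _) hw)
            simp [SimpleGraph.adjMatrix_apply, hadj.symm]
        _ ≤ ∑ u, ∑ w ∈ Xᶜ ∪ C j, (G.adjMatrix ℝ w u * x u) ^ 2 :=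
            Finset.sum_le_sum_of_subset_of_nonneg (Finset.subset_univ _)
              fun _ _ _ => Finset.sum_nonneg fun _ _ => sq_nonneg _
        _ = ∑ w ∈ Xᶜ ∪ C j, ∑ u, (G.adjMatrix ℝ w u * x u) ^ 2 := Finset.sum_comm
        _ ≤ _ := Finset.sum_le_sum fun w _ => Finset.sum_sq_le_sq_sum_of_nonneg
            fun u _ => mul_nonneg (adjMatrix_nonneg w u) (hx0 u)
    have hdisj : Disjoint Xᶜ (C j) := by
      rw [Finset.disjoint_left]
      intro u hu hu'
      exact Finset.mem_compl.1 hu (Finset.mem_filter.1 hu').1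
    rw [Finset.sum_union hdisj] at h2
    have h3 : ∑ w ∈ Xᶜ, (G.adjMatrix ℝ *ᵥ x) w ^ 2 = s := by
      rw [hs]
      refine Finset.sum_congr ?_ fun _ _ => rfl
      ext u; simp
    have h4 : ∑ w ∈ C j, (G.adjMatrix ℝ *ᵥ x) w ^ 2 ≤ lam ^ 2 * ∑ u ∈ C j, x u ^ 2 := by
      rw [Finset.mul_sum]
      refine Finset.sum_le_sum fun u hu => ?_
      rw [hper u (Finset.mem_filter.1 hu).1, mul_pow]
      exact mul_le_mul_of_nonneg_right (pow_le_pow_left₀ hμ0 hμlam 2) (sq_nonneg _)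
    linarith
  have hC0 : ∑ u ∈ C 0, x u ^ 2 = 0 := by
    refine Finset.sum_eq_zero fun u hu => ?_
    obtain ⟨huX, w, hwX, hw⟩ := Finset.mem_filter.1 hu
    rw [mem_closedBall, Nat.cast_zero, nonpos_iff_eq_zero, SimpleGraph.edist_eq_zero_iff] at hw
    exact absurd (hw ▸ huX) hwX
  have hC4 : ∑ u ∈ C 4, x u ^ 2 ≤ 4 * lam ^ 6 * s := by
    have c1 := hstep 0
    have c2 := hstep 1
    have c3 := hstep 2
    have c4 := hstep 3
    norm_num at c1 c2 c3 c4
    rw [hC0] at c1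
    have hl2 : 1 ≤ lam ^ 2 := one_le_pow₀ hlam
    have d2 : lam ^ 2 * ∑ u ∈ C 1, x u ^ 2 ≤ lam ^ 2 * s :=
      mul_le_mul_of_nonneg_left (by linarith) (by positivity)
    have d3 : lam ^ 2 * ∑ u ∈ C 2, x u ^ 2 ≤ lam ^ 2 * (s + lam ^ 2 * s) :=
      mul_le_mul_of_nonneg_left (by linarith) (by positivity)
    have d4 : lam ^ 2 * ∑ u ∈ C 3, x u ^ 2 ≤ lam ^ 2 * (s + lam ^ 2 * (s + lam ^ 2 * s)) :=
      mul_le_mul_of_nonneg_left (by linarith) (by positivity)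
    have p0 : s ≤ lam ^ 6 * s := le_mul_of_one_le_left hs0 (one_le_pow₀ hlam)
    have p2 : lam ^ 2 * s ≤ lam ^ 6 * s :=
      mul_le_mul_of_nonneg_right (pow_le_pow_right₀ hlam (by norm_num)) hs0
    have p4 : lam ^ 4 * s ≤ lam ^ 6 * s :=
      mul_le_mul_of_nonneg_right (pow_le_pow_right₀ hlam (by norm_num)) hs0
    nlinarith
  -- comparison of the weights of low and high degree vertices
  set xT : V → ℝ := fun u => if (G.degree u : ℝ) ≤ lam - 1 / 2 then x u else 0 with hxT
  set xS : V → ℝ := fun u => if (G.degree u : ℝ) ≤ lam - 1 / 2 then 0 else x u with hxS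
  have hsum : x = xT + xS := by
    ext u; simp only [hxT, hxS, Pi.add_apply]; split_ifs <;> simp
  have hxS0 : ∀ u, 0 ≤ xS u := fun u => by simp only [hxS]; split_ifs <;> simp [hx0]
  have hdot : ∀ z : V → ℝ, (∀ u, z u = 0 ∨ z u = x u) →
      z ⬝ᵥ G.adjMatrix ℝ *ᵥ x = μ * (z ⬝ᵥ z) := by
    intro z hz
    rw [dotProduct, dotProduct, Finset.mul_sum]
    refine Finset.sum_congr rfl fun u _ => ?_
    rcases hz u with hu | hu
    · simp [hu]
    · by_cases huX : u ∈ X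
      · rw [hper u huX, hu]; ring
      · rw [hu, hxs u huX]; simp
  have hT := hdot xT fun u => by simp only [hxT]; split_ifs <;> simp
  have hS := hdot xS fun u => by simp only [hxS]; split_ifs <;> simp
  have hTT : xT ⬝ᵥ G.adjMatrix ℝ *ᵥ xT ≤ (lam - 1 / 2) * (xT ⬝ᵥ xT) := by
    refine formLE_of_degree_le (s := {u | (G.degree u : ℝ) ≤ lam - 1 / 2}) (fun u hu => ?_) xT
      fun u hu => ?_
    · simpa using hu
    · simp only [Finset.mem_filter, Finset.mem_univ, true_and] at hu
      simp only [hxT, if_neg hu]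
  have hTS : xT ⬝ᵥ G.adjMatrix ℝ *ᵥ xS ≤ μ * (xS ⬝ᵥ xS) := by
    rw [← hS, dotProduct_mulVec_comm hA]
    refine Finset.sum_le_sum fun u _ => mul_le_mul_of_nonneg_left ?_ (hxS0 u)
    refine Finset.sum_le_sum fun w _ => mul_le_mul_of_nonneg_left ?_ (adjMatrix_nonneg u w)
    simp only [hxT]; split_ifs <;> simp [hx0]
  have hT2 : μ * (xT ⬝ᵥ xT) ≤ (lam - 1 / 2) * (xT ⬝ᵥ xT) + μ * (xS ⬝ᵥ xS) := by
    rw [← hT]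
    have hsplit : xT ⬝ᵥ G.adjMatrix ℝ *ᵥ x
        = xT ⬝ᵥ G.adjMatrix ℝ *ᵥ xT + xT ⬝ᵥ G.adjMatrix ℝ *ᵥ xS := by
      rw [← dotProduct_add, ← mulVec_add, ← hsum]
    linarith
  have hab : xT ⬝ᵥ xT + xS ⬝ᵥ xS = 1 := by
    rw [← hx1, dotProduct, dotProduct, dotProduct, ← Finset.sum_add_distrib]
    refine Finset.sum_congr rfl fun u _ => ?_
    simp only [hxT, hxS]; split_ifs <;> simp
  have hSC : xS ⬝ᵥ xS ≤ ∑ u ∈ C 4, x u ^ 2 := by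
    have h1 : ∑ u ∈ C 4, x u ^ 2 = ∑ u, if u ∈ C 4 then x u ^ 2 else 0 := by
      rw [Finset.sum_ite_mem, Finset.univ_inter]
    rw [h1]
    refine Finset.sum_le_sum fun u _ => ?_
    by_cases hd : (G.degree u : ℝ) ≤ lam - 1 / 2
    · simp only [hxS, if_pos hd, mul_zero]
      split_ifs <;> positivity
    · by_cases huX : u ∈ X
      · rw [if_pos (Finset.mem_filter.2 ⟨huX, hexit u huX (not_le.1 hd)⟩)]
        simp only [hxS, if_neg hd, pow_two, le_refl]
      · simp only [hxS, if_neg hd, hxs u huX, mul_zero]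
        split_ifs <;> norm_num
  have ha0 := dotProduct_self_nonneg_real xT
  have hb0 := dotProduct_self_nonneg_real xS
  set a := xT ⬝ᵥ xT
  set b := xS ⬝ᵥ xS
  have hgap_le : 1 / (20 * lam ^ 8) ≤ 1 / 4 := by
    apply one_div_le_one_div_of_le (by norm_num)
    have := one_le_pow₀ hlam (n := 8)
    linarith
  -- If `μ` is near `lam`, the low-degree part cannot carry the form alone, so the high-degree part
  -- has weight `b ≥ 1/(5 lam)`. It lies in `C 4`, whose weight is at most `4 lam⁶ s`; hence `s/lam
  -- ≥ 1/(20 lam⁸)`.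
  rcases le_total μ (lam - 1 / 4) with hcase | hcase
  · linarith
  · have h1 : a / 4 ≤ lam * b := by nlinarith
    have h2 : 1 ≤ 5 * lam * b := by nlinarith
    have h3 : 1 ≤ 20 * lam ^ 7 * s := by
      calc (1 : ℝ) ≤ 5 * lam * b := h2
        _ ≤ 5 * lam * (4 * lam ^ 6 * s) :=
          mul_le_mul_of_nonneg_left (hSC.trans hC4) (by positivity)
        _ = _ := by ring
    have h4 : 1 / (20 * lam ^ 8) ≤ s / lam := by
      rw [div_le_div_iff₀ (by positivity) (by positivity)]
      nlinarith
    linarith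

end SpectralGap


/-! ### Second bound: packings and dominated components -/

section SecondBound

variable {V : Type*} [Fintype V] [DecidableEq V]

/-- A maximal subfamily of pairwise disjoint sets. -/
theorem exists_maximal_packing (P : Finset V) (B : V → Finset V) (hB : ∀ v, v ∈ B v) :
    ∃ T ⊆ P, (∀ u ∈ T, ∀ v ∈ T, u ≠ v → Disjoint (B u) (B v)) ∧
      ∀ u ∈ P, ∃ t ∈ T, ¬ Disjoint (B u) (B t) := by
  classical
  let S : Finset (Finset V) :=
    P.powerset.filter fun T => ∀ u ∈ T, ∀ v ∈ T, u ≠ v → Disjoint (B u) (B v)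
  obtain ⟨T, hT, hmax⟩ := S.exists_max_image Finset.card ⟨∅, by simp [S]⟩
  obtain ⟨hTP, hTd⟩ := Finset.mem_filter.1 hT
  rw [Finset.mem_powerset] at hTP
  refine ⟨T, hTP, hTd, fun u hu => ?_⟩
  by_contra! hno
  have huT : u ∉ T := fun h => by
    have := hno u h
    rw [Finset.disjoint_self_iff_empty] at this
    exact absurd (hB u) (by simp [this])
  have hins : insert u T ∈ S := by
    refine Finset.mem_filter.2 ⟨Finset.mem_powerset.2 (Finset.insert_subset hu hTP), ?_⟩
    intro a ha b hb hab
    rcases Finset.mem_insert.1 ha with rfl | ha' <;> rcases Finset.mem_insert.1 hb with rfl | hb'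
    · exact absurd rfl hab
    · exact hno b hb'
    · exact (hno a ha').symm
    · exact hTd a ha' b hb' hab
  have := hmax _ hins
  rw [Finset.card_insert_of_notMem huT] at this
  omega

theorem card_mul_le_of_packing {T S : Finset V} {B : V → Finset V}
    (hd : ∀ u ∈ T, ∀ v ∈ T, u ≠ v → Disjoint (B u) (B v)) (hBS : ∀ v ∈ T, B v ⊆ S) {c : ℝ}
    (hc : ∀ v ∈ T, c ≤ #(B v)) : #T * c ≤ #S := by
  have h1 : #(T.biUnion B) = ∑ v ∈ T, #(B v) := Finset.card_biUnion hd
  have h2 : #(T.biUnion B) ≤ #S := Finset.card_le_card (Finset.biUnion_subset.2 hBS)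
  calc #T * c = ∑ _v ∈ T, c := by rw [Finset.sum_const, nsmul_eq_mul]
    _ ≤ ∑ v ∈ T, (#(B v) : ℝ) := Finset.sum_le_sum hc
    _ = ((∑ v ∈ T, #(B v) : ℕ) : ℝ) := by push_cast; rfl
    _ ≤ #S := by rw [← h1]; exact_mod_cast h2

variable {G : SimpleGraph V} [DecidableRel G.Adj]

theorem card_closedBall_one (v : V) : #(closedBall G 1 v) = G.degree v + 1 := by
  have : closedBall G 1 v = insert v (G.neighborFinset v) := by
    ext u; rw [mem_closedBall_one]; simp
  rw [this, Finset.card_insert_of_notMem (by simp), SimpleGraph.card_neighborFinset_eq_degree]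

/-- The restriction of an eigenvector to a union of components is an eigenvector. -/
theorem mulVec_restrict_of_closed {C : Finset V} (hC : ∀ w ∈ C, ∀ w', G.Adj w w' → w' ∈ C)
    {lam : ℝ} {f : V → ℝ} (hf : G.adjMatrix ℝ *ᵥ f = lam • f) :
    G.adjMatrix ℝ *ᵥ (fun w => if w ∈ C then f w else 0)
      = lam • fun w => if w ∈ C then f w else 0 := by
  ext u
  rw [SimpleGraph.adjMatrix_mulVec_apply, Pi.smul_apply, smul_eq_mul]
  by_cases hu : u ∈ C
  · have h1 := congrFun hf u
    rw [SimpleGraph.adjMatrix_mulVec_apply, Pi.smul_apply, smul_eq_mul] at h1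
    rw [if_pos hu, ← h1]
    exact Finset.sum_congr rfl fun w hw =>
      if_pos (hC u hu w ((G.mem_neighborFinset _ _).1 hw))
  · rw [if_neg hu, mul_zero]
    refine Finset.sum_eq_zero fun w hw => if_neg fun hw' => hu ?_
    exact hC w hw' u ((G.mem_neighborFinset _ _).1 hw).symm

/-- An eigenvector vanishes on the components with few vertices. -/
theorem eigenvector_eq_zero_of_card_lt {C : Finset V}
    (hC : ∀ w ∈ C, ∀ w', G.Adj w w' → w' ∈ C) {lam : ℝ} (hcard : (#C : ℝ) < lam + 1)
    {f : V → ℝ} (hf : G.adjMatrix ℝ *ᵥ f = lam • f) {u : V} (hu : u ∈ C) : f u = 0 := by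
  set g : V → ℝ := fun w => if w ∈ C then f w else 0 with hg
  have hdeg : ∀ w ∈ C, (G.degree w : ℝ) ≤ #C - 1 := by
    intro w hw
    have h1 : closedBall G 1 w ⊆ C := by
      intro w' hw'
      rcases mem_closedBall_one.1 hw' with rfl | h
      · exact hw
      · exact hC w hw w' h
    have h2 := Finset.card_le_card h1
    rw [card_closedBall_one] at h2
    have h3 : (G.degree w : ℝ) + 1 ≤ #C := by exact_mod_cast h2
    linarith
  -- Degrees inside `C` are at most `#C - 1 < lam`, so `lam` cannot be an eigenvalue there.
  have h1 := formLE_of_degree_le hdeg g fun w hw => if_neg hw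
  rw [mulVec_restrict_of_closed hC hf, dotProduct_smul, smul_eq_mul] at h1
  have h2 := dotProduct_self_nonneg_real g
  have h3 : g ⬝ᵥ g = 0 := by nlinarith
  have h4 := congrFun (dotProduct_self_eq_zero.1 h3) u
  simpa [hg, hu] using h4

/-- In a component with quadratic form at most `lam`, an eigenvector for `lam` which vanishes at a
vertex vanishes at its neighbours. -/
theorem eigenvector_eq_zero_of_adj {C : Finset V}
    (hC : ∀ w ∈ C, ∀ w', G.Adj w w' → w' ∈ C) {lam : ℝ}
    (hform : FormLE (G.adjMatrix ℝ) C lam) {f : V → ℝ} (hf : G.adjMatrix ℝ *ᵥ f = lam • f)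
    {t u : V} (ht : t ∈ C) (hft : f t = 0) (htu : G.Adj t u) : f u = 0 := by
  set g : V → ℝ := fun w => if w ∈ C then f w else 0 with hg
  have hgs : ∀ w, w ∉ C → |g| w = 0 := fun w hw => by simp [hg, hw]
  -- Passing to `|g|` cannot lower the form, so `|g|` is a maximizer and again an eigenvector; at a
  -- zero of it the neighbouring values are nonnegative with sum zero.
  have h1 := (le_abs_self _).trans (abs_form_le_form_abs (adjMatrix_nonneg (G := G)) g)
  rw [mulVec_restrict_of_closed hC hf, dotProduct_smul, smul_eq_mul, ← hg,
    ← abs_dotProduct_abs] at h1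
  have h2 := hform.mulVec_eq_of_eq (G.isHermitian_adjMatrix ℝ) hgs
    (le_antisymm (hform _ hgs) h1) ht
  have h3 : |g| t = 0 := by simp [hg, hft]
  rw [h3, mul_zero, SimpleGraph.adjMatrix_mulVec_apply] at h2
  have h4 := (Finset.sum_eq_zero_iff_of_nonneg fun w _ => abs_nonneg (g w)).1 h2 u
    ((G.mem_neighborFinset _ _).2 htu)
  simpa [hg, hC t ht u htu] using h4

/-- The sharp multiplicity bound for graphs in which the quadratic form of every ball is at most
`lam`. -/
theorem eigMultiplicity_le_div_of_locally_bounded {lam : ℝ} (hlam : 1 ≤ lam) {k : ℕ} (hk : 1 ≤ k)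
    (h : ∀ v, FormLE (G.adjMatrix ℝ) (closedBall G (k + 1) v) lam)
    (hnum : (1 - 1 / (20 * lam ^ 9)) ^ (2 * k) ≤ 1 / (lam + 1) - 1 / (lam + 3 / 2)) :
    (eigMultiplicity G lam : ℝ) ≤ Fintype.card V / (lam + 1) := by
  classical
  -- `dom u` says that `u` dominates its component, which is then its 1-ball; `Z` is the union of
  -- these components.
  set dom : V → Prop := fun u => closedBall G 2 u ⊆ closedBall G 1 u with hdom
  set Z : Finset V := {v | ∃ u, dom u ∧ v ∈ closedBall G 1 u} with hZ
  have hclosed : ∀ u, dom u → ∀ w ∈ closedBall G 1 u, ∀ w', G.Adj w w' → w' ∈ closedBall G 1 u :=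
    fun u hu w hw w' hadj => hu (mem_closedBall_of_adj hw hadj)
  have hZc : ∀ w ∈ Z, ∀ w', G.Adj w w' → w' ∈ Z := by
    intro w hw w' hadj
    simp only [hZ, Finset.mem_filter, Finset.mem_univ, true_and] at hw ⊢
    obtain ⟨u, hu, hwu⟩ := hw
    exact ⟨u, hu, hclosed u hu w hwu w' hadj⟩
  have hZball : ∀ j v, (∃ w ∈ closedBall G j v, w ∈ Z) → v ∈ Z := by
    intro j
    induction j with
    | zero =>
      rintro v ⟨w, hw, hwZ⟩
      rw [mem_closedBall, Nat.cast_zero, nonpos_iff_eq_zero, SimpleGraph.edist_eq_zero_iff] at hw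
      exact hw ▸ hwZ
    | succ j ih =>
      rintro v ⟨w, hw, hwZ⟩
      rcases exists_adj_of_mem_closedBall_succ hw with rfl | ⟨w', hadj, hw'⟩
      · exact hwZ
      · exact hZc w' (ih w' ⟨w, hw', hwZ⟩) v hadj.symm
  -- `V₁` will be deleted to create the gap; `V₂` picks one vertex from each dominated component
  -- with at least `lam + 1` vertices. All of `Z` can then be removed at the price of `V₂` alone.
  obtain ⟨V₁, hV₁, hd₁, hm₁⟩ := exists_maximal_packing
    ({v | v ∉ Z ∧ lam - 1 / 2 < (G.degree v : ℝ)} : Finset V) (closedBall G 2)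
    (self_mem_closedBall 2)
  obtain ⟨V₂, hV₂, hd₂, hm₂⟩ := exists_maximal_packing
    ({v | dom v ∧ lam + 1 ≤ (#(closedBall G 1 v) : ℝ)} : Finset V) (closedBall G 1)
    (self_mem_closedBall 1)
  have hV₁' : ∀ v ∈ V₁, v ∉ Z ∧ lam - 1 / 2 < (G.degree v : ℝ) := fun v hv => by
    simpa using hV₁ hv
  have hV₂' : ∀ v ∈ V₂, dom v ∧ lam + 1 ≤ (#(closedBall G 1 v) : ℝ) := fun v hv => by
    simpa using hV₂ hv
  -- eigenvectors vanishing on the packing vanish on the small components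
  have hvan : ∀ f : V → ℝ, G.adjMatrix ℝ *ᵥ f = lam • f → (∀ u ∈ V₁ ∪ V₂, f u = 0) →
      ∀ u ∈ V₁ ∪ Z, f u = 0 := by
    intro f hf hf0 u hu
    rcases Finset.mem_union.1 hu with hu | hu
    · exact hf0 u (Finset.mem_union_left _ hu)
    simp only [hZ, Finset.mem_filter, Finset.mem_univ, true_and] at hu
    obtain ⟨u₀, hu₀, huu₀⟩ := hu
    rcases lt_or_ge (#(closedBall G 1 u₀) : ℝ) (lam + 1) with hlt | hge
    · exact eigenvector_eq_zero_of_card_lt (hclosed u₀ hu₀) hlt hf huu₀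
    obtain ⟨t, ht, hdis⟩ := hm₂ u₀ (by simp [hu₀, hge])
    obtain ⟨w, hw₀, hwt⟩ := Finset.not_disjoint_iff.1 hdis
    have htc := hclosed t (hV₂' t ht).1
    have hft : f t = 0 := hf0 t (Finset.mem_union_right _ ht)
    have hu₀t : u₀ ∈ closedBall G 1 t := by
      rcases mem_closedBall_one.1 hw₀ with rfl | hadj
      · exact hwt
      · exact htc w hwt u₀ hadj.symm
    have hut : u ∈ closedBall G 1 t := by
      rcases mem_closedBall_one.1 huu₀ with rfl | hadj
      · exact hu₀t
      · exact htc u₀ hu₀t u hadj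
    rcases mem_closedBall_one.1 hut with rfl | hadj
    · exact hft
    · exact eigenvector_eq_zero_of_adj htc ((h t).mono (closedBall_mono (by omega) t)) hf
        (self_mem_closedBall 1 t) hft hadj
  have hm := eigMultiplicity_le_add_isolate hvan
  -- the remaining graph has a spectral gap
  set Q := V₁ ∪ Z with hQ
  have hl9 : 1 / (20 * lam ^ 9) < 1 := by
    rw [div_lt_one (by positivity)]
    have := one_le_pow₀ hlam (n := 9)
    linarith
  have hμ : lam - 1 / (20 * lam ^ 8) = lam * (1 - 1 / (20 * lam ^ 9)) := by
    field_simp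
  have hμ0 : 0 < lam - 1 / (20 * lam ^ 8) := by
    rw [hμ]; exact mul_pos (by linarith) (by linarith)
  have hgap : ∀ v, FormLE ((isolate G Q).adjMatrix ℝ) (closedBall (isolate G Q) k v)
      (lam - 1 / (20 * lam ^ 8)) := by
    intro v
    refine FormLE.isolate hμ0.le fun _ =>
      formLE_sub_of_exit hlam (h v) Finset.sdiff_subset fun u hu hdeg => ?_
    have huQ := (Finset.mem_sdiff.1 hu).2
    -- By maximality the 2-ball of `u` meets that of some `t` in `V₁`, so `t` is a deleted vertex
    -- within distance 4.
    obtain ⟨t, ht, hdis⟩ := hm₁ u (by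
      simp only [Finset.mem_filter, Finset.mem_univ, true_and]
      exact ⟨fun huZ => huQ (Finset.mem_union_right _ huZ), hdeg⟩)
    obtain ⟨w, hwu, hwt⟩ := Finset.not_disjoint_iff.1 hdis
    refine ⟨t, fun ht' => (Finset.mem_sdiff.1 ht').2 (Finset.mem_union_left _ ht), ?_⟩
    rw [mem_closedBall] at *
    rw [SimpleGraph.edist_comm] at hwt
    calc G.edist u t ≤ G.edist u w + G.edist w t := G.edist_triangle
      _ ≤ (2 : ℕ) + (2 : ℕ) := add_le_add hwu hwt
      _ = ((4 : ℕ) : ℕ∞) := by norm_num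
  set η := (1 - 1 / (20 * lam ^ 9)) ^ (2 * k) with hη
  have hη0 : 0 ≤ η := pow_nonneg (by linarith) _
  have hiso : (eigMultiplicity (isolate G Q) lam : ℝ) ≤ #Zᶜ * η := by
    have htr := finrank_eigenspace_mul_pow_le_trace ((isolate G Q).isHermitian_adjMatrix ℝ) lam k
    have hsum : ((isolate G Q).adjMatrix ℝ ^ (2 * k)).trace
        ≤ ∑ v ∈ Zᶜ, (lam - 1 / (20 * lam ^ 8)) ^ (2 * k) := by
      rw [Matrix.trace, ← Finset.sum_add_sum_compl Z]
      have h0 : ∑ v ∈ Z, ((isolate G Q).adjMatrix ℝ ^ (2 * k)).diag v = 0 :=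
        Finset.sum_eq_zero fun v hv =>
          adjMatrix_isolate_pow_diag_of_mem (by omega) (Finset.mem_union_right _ hv)
      rw [h0, zero_add]
      exact Finset.sum_le_sum fun v _ => (hgap v).adjMatrix_pow_diag_le hμ0
    have h1 := htr.trans hsum
    rw [Finset.sum_const, nsmul_eq_mul, hμ, mul_pow, ← hη, mul_comm (lam ^ (2 * k)), ← mul_assoc]
      at h1
    exact le_of_mul_le_mul_right h1 (by positivity)
  -- counting
  have hc₁ : #V₁ * (lam + 3 / 2) ≤ (#Zᶜ : ℝ) := by
    refine card_mul_le_of_packing hd₁ (fun v hv w hw => ?_) fun v hv => ?_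
    · exact Finset.mem_compl.2 fun hwZ => (hV₁' v hv).1 (hZball 2 v ⟨w, hw, hwZ⟩)
    · obtain ⟨hvZ, hdeg⟩ := hV₁' v hv
      -- As `v` does not dominate, its 2-ball has a vertex beyond its 1-ball, hence at least `deg v
      -- + 2 > lam + 3/2` vertices.
      have hnd : ¬ dom v := fun hd => hvZ (by
        simp only [hZ, Finset.mem_filter, Finset.mem_univ, true_and]
        exact ⟨v, hd, self_mem_closedBall 1 v⟩)
      have hss : closedBall G 1 v ⊂ closedBall G 2 v :=
        Finset.ssubset_iff_subset_ne.2 ⟨closedBall_mono (by norm_num) v,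
          fun heq => hnd heq.symm.subset⟩
      have h1 := Finset.card_lt_card hss
      rw [card_closedBall_one] at h1
      have h2 : (G.degree v : ℝ) + 1 + 1 ≤ #(closedBall G 2 v) := by exact_mod_cast h1
      linarith
  have hc₂ : #V₂ * (lam + 1) ≤ (#Z : ℝ) := by
    refine card_mul_le_of_packing hd₂ (fun v hv w hw => ?_) fun v hv => (hV₂' v hv).2
    simp only [hZ, Finset.mem_filter, Finset.mem_univ, true_and]
    exact ⟨v, (hV₂' v hv).1, hw⟩
  have hcard : (#Zᶜ : ℝ) + #Z = Fintype.card V := by exact_mod_cast Finset.card_compl_add_card Z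
  have hm' : (eigMultiplicity G lam : ℝ) ≤ #V₁ + #V₂ + eigMultiplicity (isolate G Q) lam := by
    have := hm.trans (Nat.add_le_add_right (Finset.card_union_le V₁ V₂) _)
    exact_mod_cast this
  have f₁ : (#V₁ : ℝ) ≤ #Zᶜ * (1 / (lam + 3 / 2)) := by
    rw [mul_one_div, le_div_iff₀ (by linarith)]; exact hc₁
  have f₂ : (#V₂ : ℝ) ≤ #Z * (1 / (lam + 1)) := by
    rw [mul_one_div, le_div_iff₀ (by linarith)]; exact hc₂
  have f₃ : (#Zᶜ : ℝ) * η ≤ #Zᶜ * (1 / (lam + 1) - 1 / (lam + 3 / 2)) :=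
    mul_le_mul_of_nonneg_left hnum (Nat.cast_nonneg _)
  rw [← hcard, div_eq_mul_one_div]
  linarith

/-- Bernoulli gives `1 + mδ ≤ (1 + δ)^m`, and `(1 - δ)(1 + δ) ≤ 1`. -/
theorem one_sub_pow_le_inv {δ : ℝ} (h0 : 0 ≤ δ) (h1 : δ ≤ 1) (m : ℕ) :
    (1 - δ) ^ m ≤ 1 / (1 + m * δ) := by
  rw [le_div_iff₀ (by positivity)]
  calc (1 - δ) ^ m * (1 + m * δ) ≤ (1 - δ) ^ m * (1 + δ) ^ m :=
        mul_le_mul_of_nonneg_left (one_add_mul_le_pow (by linarith) m)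
          (pow_nonneg (by linarith) m)
    _ = (1 - δ ^ 2) ^ m := by rw [← mul_pow]; ring_nf
    _ ≤ 1 := pow_le_one₀ (by nlinarith) (by nlinarith [sq_nonneg δ])

/-- The exponent is `14 = 9 + 5`: nine powers cancel the gap `1/(20 lam⁹)`, and the other five amply
beat the quadratic `2 (lam + 1) (lam + 3/2)`. -/
theorem spectral_gap_pow_le {lam : ℝ} (hlam : 1 ≤ lam) {k : ℕ} (hk : 100 * (lam + 1) ^ 14 ≤ k) :
    (1 - 1 / (20 * lam ^ 9)) ^ (2 * k) ≤ 1 / (lam + 1) - 1 / (lam + 3 / 2) := by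
  have hl9 : 1 ≤ lam ^ 9 := one_le_pow₀ hlam
  have hδ1 : 1 / (20 * lam ^ 9) ≤ 1 := by
    rw [div_le_one (by positivity)]; linarith
  refine (one_sub_pow_le_inv (by positivity) hδ1 (2 * k)).trans ?_
  have h1 : 10 * (lam + 1) ^ 5 ≤ ((2 * k : ℕ) : ℝ) * (1 / (20 * lam ^ 9)) := by
    rw [mul_one_div, le_div_iff₀ (by positivity)]
    push_cast
    have h2 : lam ^ 9 ≤ (lam + 1) ^ 9 := pow_le_pow_left₀ (by linarith) (by linarith) 9
    have h3 : (lam + 1) ^ 5 * lam ^ 9 ≤ (lam + 1) ^ 5 * (lam + 1) ^ 9 :=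
      mul_le_mul_of_nonneg_left h2 (by positivity)
    rw [← pow_add] at h3
    norm_num at h3
    linarith
  have h4 : 1 / (lam + 1) - 1 / (lam + 3 / 2) = 1 / (2 * (lam + 1) * (lam + 3 / 2)) := by
    field_simp; ring
  rw [h4]
  refine one_div_le_one_div_of_le (by positivity) ?_
  have h5 : (lam + 1) ^ 2 ≤ (lam + 1) ^ 5 := pow_le_pow_right₀ (by linarith) (by norm_num)
  nlinarith

theorem eigMultiplicity_eq_zero_of_no_edges {lam : ℝ} (hlam : lam ≠ 0)
    (h : ∀ u v, ¬ G.Adj u v) : eigMultiplicity G lam = 0 := by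
  rw [eigMultiplicity, Submodule.finrank_eq_zero, Submodule.eq_bot_iff]
  intro f hf
  rw [Module.End.mem_eigenspace_iff, toLin'_apply] at hf
  ext u
  have h1 := congrFun hf u
  rw [SimpleGraph.adjMatrix_mulVec_apply, Finset.sum_eq_zero fun w hw =>
    absurd ((G.mem_neighborFinset _ _).1 hw) (h u w)] at h1
  simpa [hlam] using h1.symm

variable (G) in
theorem eigMultiplicity_lambda2_le_div_add_rpow (hn : 2 ≤ Fintype.card V) {Δ : ℝ} (hΔ : 2 ≤ Δ)
    (hdeg : (G.maxDegree : ℝ) ≤ Δ) (hne : lambda2 G hn ≠ -1) {ε : ℝ} (hε : 0 < ε)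
    (hL : ε⁻¹ * (2 * lambda2 G hn + 2) ^ 14 * Real.logb 2 (lambda2 G hn + 2)
      ≤ Real.logb Δ (Fintype.card V : ℝ)) :
    (eigMultiplicity G (lambda2 G hn) : ℝ)
      ≤ (Fintype.card V : ℝ) / (lambda2 G hn + 1) + (Fintype.card V : ℝ) ^ ε := by
  have hn2 : (2 : ℝ) ≤ Fintype.card V := by exact_mod_cast hn
  have hge := neg_one_le_lambda2 G hn
  have hpos : 0 < lambda2 G hn + 1 := by
    have := lt_of_le_of_ne hge (Ne.symm hne)
    linarith
  have hnε : 0 ≤ (Fintype.card V : ℝ) ^ ε := Real.rpow_nonneg (by linarith) ε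
  rcases le_or_gt (lambda2 G hn) 0 with hlam0 | hlam0
  -- For `-1 < λ₂ ≤ 0` the term `n / (λ₂ + 1)` is already at least `n`.
  · have h1 : (eigMultiplicity G (lambda2 G hn) : ℝ) ≤ Fintype.card V := by
      exact_mod_cast eigMultiplicity_le_card G _
    have h2 : (Fintype.card V : ℝ) ≤ Fintype.card V / (lambda2 G hn + 1) := by
      rw [le_div_iff₀ hpos]
      nlinarith
    linarith
  set lam := lambda2 G hn with hlamdef
  set L := Real.logb Δ (Fintype.card V : ℝ) with hLdef
  have hcard : (Fintype.card V : ℝ) = Δ ^ L :=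
    (Real.rpow_logb (by linarith) (by linarith) (by linarith)).symm
  have hlog : 1 ≤ Real.logb 2 (lam + 2) := by
    exact_mod_cast nat_le_logb_two (x := lam + 2) (a := 1) (by norm_num; linarith)
  have hεL : 2 ^ 14 * (lam + 1) ^ 14 ≤ ε * L := by
    have h1 : ε * (ε⁻¹ * (2 * lam + 2) ^ 14 * Real.logb 2 (lam + 2)) ≤ ε * L :=
      mul_le_mul_of_nonneg_left hL hε.le
    have h2 : ε * (ε⁻¹ * (2 * lam + 2) ^ 14 * Real.logb 2 (lam + 2))
        = 2 ^ 14 * (lam + 1) ^ 14 * Real.logb 2 (lam + 2) := by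
      rw [show 2 * lam + 2 = 2 * (lam + 1) by ring, mul_pow]
      field_simp
    rw [h2] at h1
    refine le_trans ?_ h1
    exact le_mul_of_one_le_right (by positivity) hlog
  have hl14 : 1 ≤ (lam + 1) ^ 14 := one_le_pow₀ (by linarith)
  have hU : ∀ k : ℕ, 2 * (k : ℝ) + 2 ≤ ε * L → Δ ^ (2 * k + 2) ≤ (Fintype.card V : ℝ) ^ ε := by
    intro k hk
    rw [hcard, ← Real.rpow_mul (by linarith), ← Real.rpow_natCast]
    refine Real.rpow_le_rpow_of_exponent_le (by linarith) ?_
    push_cast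
    linarith
  rcases lt_or_ge lam 1 with hlam1 | hlam1
  -- For `0 < lam < 1` the local bound gives degrees at most `lam² < 1`: no edge survives the
  -- deletion of `U`.
  · obtain ⟨U, hUcard, hm, hloc⟩ := exists_isolate_locally_bounded G hn hΔ hdeg hlam0.le 1
    have h0 : eigMultiplicity (isolate G U) lam = 0 := by
      refine eigMultiplicity_eq_zero_of_no_edges hlam0.ne' fun u v huv => ?_
      have h1 := (hloc u).degree_le le_rfl hlam0
      have h2 : 0 < (isolate G U).degree u :=
        (SimpleGraph.degree_pos_iff_exists_adj _ _).2 ⟨v, huv⟩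
      have h3 : (1 : ℝ) ≤ (isolate G U).degree u := by exact_mod_cast h2
      nlinarith
    rw [← hlamdef, h0, add_zero] at hm
    have h1 : (eigMultiplicity G lam : ℝ) ≤ #U := by exact_mod_cast hm
    have h2 := hU 1 (by norm_num at hεL ⊢; linarith)
    have h3 : 0 ≤ (Fintype.card V : ℝ) / (lam + 1) := by positivity
    linarith
  · set K := ⌊ε * L / 2⌋₊ with hK
    have hKle : (K : ℝ) ≤ ε * L / 2 := Nat.floor_le (by linarith)
    have hKge : ε * L / 2 - 1 < K := Nat.sub_one_lt_floor _
    have hK3 : (3 : ℝ) ≤ K := by norm_num at hεL; linarith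
    -- The gap argument at radius `k` needs local bounds at radius `k + 1`, whose exceptional set
    -- has size at most `Δ^(2(k+1)+2) = Δ^(2K) ≤ n^ε`.
    obtain ⟨k, hk⟩ : ∃ k, K = k + 2 := Nat.exists_eq_add_of_le' (by
      have : 3 ≤ K := by exact_mod_cast hK3
      omega)
    have hkR : (K : ℝ) = k + 2 := by rw [hk]; push_cast; ring
    have hk1 : 1 ≤ k := by
      have : 3 ≤ K := by exact_mod_cast hK3
      omega
    obtain ⟨U, hUcard, hm, hloc⟩ := exists_isolate_locally_bounded G hn hΔ hdeg hlam0.le (k + 1)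
    have h1 := eigMultiplicity_le_div_of_locally_bounded hlam1 hk1 hloc
      (spectral_gap_pow_le hlam1 (by norm_num at hεL; linarith))
    have h2 := hU (k + 1) (by push_cast; linarith)
    have h3 : (eigMultiplicity G lam : ℝ) ≤ #U + eigMultiplicity (isolate G U) lam := by
      exact_mod_cast hm
    linarith

end SecondBound

end SecondEigenvalue

theorem theorem2p6 {V : Type*} [Fintype V] [DecidableEq V]
    (G : SimpleGraph V) [DecidableRel G.Adj]
    (n : ℕ) (hcard : Fintype.card V = n) (hn : 2 ≤ Fintype.card V)
    (Δ : ℝ) (hΔ : 2 ≤ Δ) (hdeg : (G.maxDegree : ℝ) ≤ Δ)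
    (lam : ℝ) (hlam : lam = SecondEigenvalue.lambda2 G hn) :
    (Δ ≤ (n : ℝ) ^ 9 →
      (SecondEigenvalue.eigMultiplicity G lam : ℝ) ≤
        5 * (n : ℝ) * max (SecondEigenvalue.logRatio lam)
          ((Real.logb 2 (1 + Real.logb Δ (n : ℝ))) ^ 2 / Real.logb Δ (n : ℝ))) ∧
    (lam ≠ -1 → ∀ ε : ℝ, 0 < ε → ε ≤ 1 →
      ε⁻¹ * (2 * lam + 2) ^ 14 * Real.logb 2 (lam + 2) ≤ Real.logb Δ (n : ℝ) →
      (SecondEigenvalue.eigMultiplicity G lam : ℝ) ≤ (n : ℝ) / (lam + 1) + (n : ℝ) ^ ε) := by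
  subst hcard hlam
  exact ⟨SecondEigenvalue.eigMultiplicity_lambda2_le_mul_max G hn hΔ hdeg,
    fun hne _ hε _ h => SecondEigenvalue.eigMultiplicity_lambda2_le_div_add_rpow G hn hΔ hdeg hne
      hε h⟩
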